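/- Let $n\ge 1$. All balls are Euclidean balls $B=B(c_B,r_B)$ in $\mathbb{R}^n$ with $r_B>0$; $|A|$ is Lebesgue measure and $\lambda B=B(c_B,\lambda r_B)$. Let $\varphi$ be a function on the set of balls with values in $(0,\infty)$ that is doubling, i.e. $\varphi(2B)\le C\varphi(B)$ for all balls $B$, and reverse doubling, i.e. for some $\delta>0$ and some $C$ one has $\varphi(B_1)/\varphi(B_2)\le C(|B_1|/|B_2|)^{\delta}$ whenever $B_1\subset B_2$. Let $w$ be a weight, i.e. a nonnegative locally integrable function on $\mathbb{R}^n$, and write $w(A)=\int_A w$. For $1\le p<\infty$ and measurable $f$ put $$\|f\|_{\mathcal M^p(\varphi,w)}=\sup_B\Big(\frac1{\varphi(B)}\int_B|f|^pw\Big)^{1/p},\qquad \|f\|_{W\mathcal M^p(\varphi,w)}=\sup_B\sup_{t>0}\frac{t\,w(\{x\in B:|f(x)|>t\})^{1/p}}{\varphi(B)^{1/p}},$$ let $\mathcal M^p(\varphi,w)$ and $W\mathcal M^p(\varphi,w)$ be the corresponding spaces of functions with finite (quasi)norm, and let $$\|g\|_{\mathcal M^p(\varphi,w)'}=\sup\Big\{\int_{\mathbb{R}^n}|fg|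 : f\in\mathcal M^p(\varphi,w),\ \|f\|_{\mathcal M^p(\varphi,w)}\le1\Big\}.$$ Assume that $\chi_B\in\mathcal M^p(\varphi,w)$ for every ball $B$. Write $w\in A(\mathcal M^p(\varphi))$ if $$\sup_B\frac{\|\chi_B\|_{\mathcal M^p(\varphi,w)}\,\|\chi_B\|_{\mathcal M^p(\varphi,w)'}}{|B|}<\infty .$$ Fix $\kappa\in(0,1)$. For a weight $v$ write $v\in A_{p,\mathrm{loc}}$, $1<p<\infty$, $p'=p/(p-1)$, if $$\sup_B\frac{v(B)^{1/p}\big(\int_Bv^{1-p'}\big)^{1/p'}}{|B|}<\infty,$$ and $v\in A_{1,\mathrm{loc}}$ if $\sup_B\frac{v(B)}{|B|}\,\|v^{-1}\|_{L^\infty(B)}<\infty$, where both suprema are over the balls with $r_B<\kappa|c_B|$. (In all these conditions $0\cdot\infty=0$.) Let $Mf(x)=\sup_{B\ni x}\frac1{|B|}\int_B|f|$ be the Hardy--Littlewood maximal operator. Then: 1. Let $1\le p<\infty$. If $M$ is bounded from $\mathcal M^p(\varphi,w)$ to $W\mathcal M^p(\varphi,w)$, then $w\in A(\mathcal M^p(\varphi))$.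 2. Let $1<p<\infty$. If $w\in A(\mathcal M^p(\varphi))$ and $w(\cdot+a)\in A_{p,\mathrm{loc}}$ for some $a\in\mathbb{R}^n$, then $M$ is bounded on $\mathcal M^p(\varphi,w)$. 3. If $w\in A(\mathcal M^1(\varphi))$ and $w(\cdot+a)\in A_{1,\mathrm{loc}}$ for some $a\in\mathbb{R}^n$, then $M$ is bounded from $\mathcal M^1(\varphi,w)$ to $W\mathcal M^1(\varphi,w)$. -/

import Mathlib

open MeasureTheory Metric
open scoped ENNReal NNReal

namespace Morrey

noncomputable section

/-- The Euclidean space `ℝⁿ`. -/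
abbrev Rn (n : ℕ) : Type := EuclideanSpace ℝ (Fin n)

variable {n : ℕ}

/-- A weight: a nonnegative locally integrable function on `ℝⁿ`. -/
def IsWeight (w : Rn n → ℝ) : Prop :=
  (∀ x, 0 ≤ w x) ∧ LocallyIntegrable w volume

/-- `w(A) = ∫_A w`, as an extended nonnegative number. -/
def wMass (w : Rn n → ℝ) (A : Set (Rn n)) : ℝ≥0∞ :=
  ∫⁻ x in A, ENNReal.ofReal (w x)

/-! A function `φ` on the set of balls is written as a function `φ c r` of the center `c` and the
radius `r`; only its values at `r > 0` are ever used. -/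

/-- `φ` takes values in `(0, ∞)` on balls. -/
def IsPositiveOnBalls (φ : Rn n → ℝ → ℝ) : Prop :=
  ∀ c r, 0 < r → 0 < φ c r

/-- `φ` is doubling: `φ(2B) ≲ φ(B)`. -/
def IsDoubling (φ : Rn n → ℝ → ℝ) : Prop :=
  ∃ C : ℝ, ∀ c r, 0 < r → φ c (2 * r) ≤ C * φ c r

/-- `φ` is reverse doubling: for some `δ > 0`, `φ(B₁)/φ(B₂) ≲ (|B₁|/|B₂|)^δ` for all balls
`B₁ ⊆ B₂`. -/
def IsReverseDoubling (φ : Rn n → ℝ → ℝ) : Prop :=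
  ∃ δ : ℝ, 0 < δ ∧ ∃ C : ℝ, ∀ (c₁ : Rn n) (r₁ : ℝ) (c₂ : Rn n) (r₂ : ℝ), 0 < r₁ → 0 < r₂ →
    ball c₁ r₁ ⊆ ball c₂ r₂ →
      φ c₁ r₁ / φ c₂ r₂ ≤ C * (volume.real (ball c₁ r₁) / volume.real (ball c₂ r₂)) ^ δ

/-- The Morrey norm `sup_B (φ(B)⁻¹ ∫_B F^p w)^{1/p}` of a `[0, ∞]`-valued function `F`
(the norm of a real function `f` is the one of `F = |f|`). -/
def morreyNorm (φ : Rn n → ℝ → ℝ) (w : Rn n → ℝ) (p : ℝ) (F : Rn n → ℝ≥0∞) : ℝ≥0∞ :=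
  ⨆ (c : Rn n) (r : ℝ) (_ : 0 < r),
    ((∫⁻ x in ball c r, F x ^ p * ENNReal.ofReal (w x)) / ENNReal.ofReal (φ c r)) ^ (1 / p)

/-- The weak Morrey quasinorm `sup_B sup_{t > 0} t w({x ∈ B : F(x) > t})^{1/p} / φ(B)^{1/p}`. -/
def weakMorreyNorm (φ : Rn n → ℝ → ℝ) (w : Rn n → ℝ) (p : ℝ) (F : Rn n → ℝ≥0∞) : ℝ≥0∞ :=
  ⨆ (c : Rn n) (r : ℝ) (_ : 0 < r) (t : ℝ≥0) (_ : 0 < t),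
    (t : ℝ≥0∞) * wMass w {x ∈ ball c r | (t : ℝ≥0∞) < F x} ^ (1 / p)
      / ENNReal.ofReal (φ c r) ^ (1 / p)

/-- Membership in the weighted Morrey space `𝓜^p(φ, w)`. -/
def MemMorrey (φ : Rn n → ℝ → ℝ) (w : Rn n → ℝ) (p : ℝ) (f : Rn n → ℝ) : Prop :=
  AEMeasurable f volume ∧ morreyNorm φ w p (fun x => ‖f x‖ₑ) < ∞

/-- The norm of the Köthe dual: `sup {∫ |f g| : f ∈ 𝓜^p(φ, w), ‖f‖ ≤ 1}`. -/
def kotheDualNorm (φ : Rn n → ℝ → ℝ) (w : Rn n → ℝ) (p : ℝ) (g : Rn n → ℝ) : ℝ≥0∞ :=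
  ⨆ (f : Rn n → ℝ) (_ : MemMorrey φ w p f) (_ : morreyNorm φ w p (fun x => ‖f x‖ₑ) ≤ 1),
    ∫⁻ x, ‖f x * g x‖ₑ

/-- The characteristic function of the ball `B(c, r)`. -/
def ballChar (c : Rn n) (r : ℝ) : Rn n → ℝ :=
  (ball c r).indicator (fun _ => 1)

/-- The constant `sup_B ‖χ_B‖_{𝓜^p(φ,w)} ‖χ_B‖_{𝓜^p(φ,w)'} / |B|`. -/
def muckenhouptMorreyConst (φ : Rn n → ℝ → ℝ) (w : Rn n → ℝ) (p : ℝ) : ℝ≥0∞ :=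
  ⨆ (c : Rn n) (r : ℝ) (_ : 0 < r),
    morreyNorm φ w p (fun x => ‖ballChar c r x‖ₑ) * kotheDualNorm φ w p (ballChar c r)
      / volume (ball c r)

/-- The class `A(𝓜^p(φ))`. -/
def MuckenhouptMorrey (φ : Rn n → ℝ → ℝ) (p : ℝ) (w : Rn n → ℝ) : Prop :=
  muckenhouptMorreyConst φ w p < ∞

/-- The `A_{p,loc}` constant for `1 < p < ∞`, over the balls `B(c, r)` with `r < κ |c|`:
`sup_B w(B)^{1/p} (∫_B w^{1-p'})^{1/p'} / |B|`, where `p' = p/(p-1)`. -/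
def apLocConst (κ p : ℝ) (w : Rn n → ℝ) : ℝ≥0∞ :=
  ⨆ (c : Rn n) (r : ℝ) (_ : 0 < r) (_ : r < κ * ‖c‖),
    wMass w (ball c r) ^ (1 / p)
      * (∫⁻ x in ball c r, ENNReal.ofReal (w x) ^ (1 - p.conjExponent)) ^ (1 / p.conjExponent)
      / volume (ball c r)

/-- The class `A_{p,loc}`, `1 < p < ∞`. -/
def ApLoc (κ p : ℝ) (w : Rn n → ℝ) : Prop :=
  apLocConst κ p w < ∞

/-- The `A_{1,loc}` constant `sup_B w(B) ‖w⁻¹‖_{L^∞(B)} / |B|`, over the balls `B(c, r)` with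
`r < κ |c|`. -/
def a1LocConst (κ : ℝ) (w : Rn n → ℝ) : ℝ≥0∞ :=
  ⨆ (c : Rn n) (r : ℝ) (_ : 0 < r) (_ : r < κ * ‖c‖),
    wMass w (ball c r) * essSup (fun x => (ENNReal.ofReal (w x))⁻¹) (volume.restrict (ball c r))
      / volume (ball c r)

/-- The class `A_{1,loc}`. -/
def A1Loc (κ : ℝ) (w : Rn n → ℝ) : Prop :=
  a1LocConst κ w < ∞

/-- The Hardy–Littlewood maximal operator: `Mf(x) = sup_{B ∋ x} |B|⁻¹ ∫_B |f|`. -/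
def hlMaximal (f : Rn n → ℝ) (x : Rn n) : ℝ≥0∞ :=
  ⨆ (c : Rn n) (r : ℝ) (_ : 0 < r) (_ : x ∈ ball c r),
    (∫⁻ y in ball c r, ‖f y‖ₑ) / volume (ball c r)

/-- `M` is bounded on `𝓜^p(φ, w)`. -/
def MaximalBounded (φ : Rn n → ℝ → ℝ) (w : Rn n → ℝ) (p : ℝ) : Prop :=
  ∃ C : ℝ≥0, ∀ f : Rn n → ℝ, MemMorrey φ w p f →
    morreyNorm φ w p (hlMaximal f) ≤ C * morreyNorm φ w p (fun x => ‖f x‖ₑ)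

/-- `M` is bounded from `𝓜^p(φ, w)` to `W𝓜^p(φ, w)`. -/
def MaximalWeakBounded (φ : Rn n → ℝ → ℝ) (w : Rn n → ℝ) (p : ℝ) : Prop :=
  ∃ C : ℝ≥0, ∀ f : Rn n → ℝ, MemMorrey φ w p f →
    weakMorreyNorm φ w p (hlMaximal f) ≤ C * morreyNorm φ w p (fun x => ‖f x‖ₑ)

end

end Morrey

/-! Necessity. If `f` has Morrey norm at most one, then `Mf` is at least the average `s` of `|f|`
over `B` on all of `B`. For `t < s`, the level set at height `t` therefore contains `B`, and the
weak bound gives `t ‖χ_B‖ ≤ C`. Letting `t` increase to `s` and taking the supremum over `f` gives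
the condition.

Sufficiency. Call a ball `B(c, r)` local if `r` is less than `κ/8` times the distance from `c` to
`a`. On a local ball, `hlMaximal_le_max` splits the averages defining `Mf` by radius. Balls of
radius less than `r` see only `f` on `4B`, and they and their sixfold enlargements stay in the range
of the local Muckenhoupt condition (`smallBalls_local`). Weighted inequalities for the maximal
operator over such a family therefore apply, and doubling of `φ` absorbs `4B`. Balls of radius at
least `r` have triples containing `B`. There the condition `A(𝓜^p(φ))`, combined with `w(B)/φ(B) ≤
‖χ‖^p` for the characteristic function of the triple, bounds the averages by a constant whose `p`-th
power times `w(B)` is at most a multiple of `‖f‖^p φ(B)`.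

The weighted inequalities are proved for arbitrary families of balls:
`exists_lintegral_averageMaximal_rpow_mul_le` for `p > 1`, by Lerner's pointwise domination through
two unweighted-type maximal functions, and `mul_lintegral_lt_averageMaximal_le` for `p = 1`. Both
rest on Vitali's covering lemma and need doubling only on the family.

From local balls to all balls. A nonlocal ball is covered, up to the point `a`, by dyadic annuli
about `a`, each covered by a fixed number of local balls. Reverse doubling makes the values of `φ`
decay geometrically, so the bounds sum (`exists_measure_ball_le_of_local`). This applies to the
measure `(Mf)^p w` in the strong case and to `t w` restricted to `{Mf > t}` in the weak case. -/

namespace Morrey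

/-! ### Maximal operators over families of balls -/

section Maximal

variable {E : Type*} [PseudoMetricSpace E] [MeasurableSpace E]

/-- The maximal operator over a family `F` of balls (pairs of center and radius), with averages
taken with respect to `μ`. -/
noncomputable def averageMaximal (μ : Measure E) (F : Set (E × ℝ)) (g : E → ℝ≥0∞) (x : E) : ℝ≥0∞ :=
  ⨆ (b : E × ℝ) (_ : b ∈ F) (_ : x ∈ ball b.1 b.2),
    (∫⁻ y in ball b.1 b.2, g y ∂μ) / μ (ball b.1 b.2)

lemma lt_averageMaximal {μ : Measure E} {F : Set (E × ℝ)} {g : E → ℝ≥0∞} {x : E} {t : ℝ≥0∞} :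
    t < averageMaximal μ F g x ↔ ∃ b ∈ F, x ∈ ball b.1 b.2 ∧
      t < (∫⁻ y in ball b.1 b.2, g y ∂μ) / μ (ball b.1 b.2) := by
  simp only [averageMaximal, lt_iSup_iff, exists_prop]

lemma le_averageMaximal {μ : Measure E} {F : Set (E × ℝ)} (g : E → ℝ≥0∞) {x : E} {b : E × ℝ}
    (hb : b ∈ F) (hx : x ∈ ball b.1 b.2) :
    (∫⁻ y in ball b.1 b.2, g y ∂μ) / μ (ball b.1 b.2) ≤ averageMaximal μ F g x :=
  le_iSup₂_of_le b hb (le_iSup_of_le hx le_rfl)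

lemma averageMaximal_le {μ : Measure E} {F : Set (E × ℝ)} {g : E → ℝ≥0∞} {x : E} {t : ℝ≥0∞}
    (h : ∀ b ∈ F, x ∈ ball b.1 b.2 →
      (∫⁻ y in ball b.1 b.2, g y ∂μ) / μ (ball b.1 b.2) ≤ t) :
    averageMaximal μ F g x ≤ t :=
  iSup₂_le fun b hb => iSup_le (h b hb)

/-- The balls are open and the operator is uncentered: a ball witnessing the inequality at `x`
witnesses it at every point of that ball. No regularity of `g` is involved, so measurability of the
maximal function is free. -/
lemma isOpen_lt_averageMaximal (μ : Measure E) (F : Set (E × ℝ)) (g : E → ℝ≥0∞) (t : ℝ≥0∞) :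
    IsOpen {x | t < averageMaximal μ F g x} := by
  rw [isOpen_iff_mem_nhds]
  intro x hx
  obtain ⟨b, hb, hxb, h⟩ := lt_averageMaximal.1 hx
  filter_upwards [isOpen_ball.mem_nhds hxb] with y hy
  exact lt_averageMaximal.2 ⟨b, hb, hy, h⟩

lemma measurable_averageMaximal [OpensMeasurableSpace E] (μ : Measure E) (F : Set (E × ℝ))
    (g : E → ℝ≥0∞) : Measurable (averageMaximal μ F g) :=
  measurable_of_Ioi fun t => (isOpen_lt_averageMaximal μ F g t).measurableSet

lemma averageMaximal_congr_ae {μ : Measure E} {F : Set (E × ℝ)} {g h : E → ℝ≥0∞}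
    (hgh : g =ᵐ[μ] h) : averageMaximal μ F g = averageMaximal μ F h := by
  funext x
  simp only [averageMaximal]
  refine iSup_congr fun b => iSup_congr fun _ => iSup_congr fun _ => ?_
  rw [lintegral_congr_ae (ae_restrict_of_ae hgh)]

/-- The weak type `(1, 1)` inequality for the maximal operator over a family of balls on which
the measure is doubling. -/
theorem mul_meas_lt_averageMaximal_le [OpensMeasurableSpace E] [TopologicalSpace.SeparableSpace E]
    {μ : Measure E} {F : Set (E × ℝ)} {R : ℝ} (hR : ∀ b ∈ F, b.2 ≤ R) {D : ℝ≥0∞}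
    (hD : ∀ b ∈ F, μ (ball b.1 (6 * b.2)) ≤ D * μ (ball b.1 b.2)) (g : E → ℝ≥0∞) (t : ℝ≥0∞) :
    t * μ {x | t < averageMaximal μ F g x} ≤ D * ∫⁻ x, g x ∂μ := by
  set T : Set (E × ℝ) :=
    {b ∈ F | t < (∫⁻ y in ball b.1 b.2, g y ∂μ) / μ (ball b.1 b.2)} with hT
  have hpos : ∀ b ∈ T, 0 < b.2 := by
    intro b hb
    by_contra! h
    have := hb.2
    simp [ball_eq_empty.2 h] at this
  -- Vitali yields closed balls enlarged by 5. These lie in the open balls enlarged by 6, which is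
  -- where the factor 6 in the doubling hypothesis comes from.
  obtain ⟨u, huT, hdisj, hcov⟩ := Vitali.exists_disjoint_subfamily_covering_enlargement_closedBall
    T Prod.fst Prod.snd R (fun b hb => hR b hb.1) 5 (by norm_num)
  have hdisj' : u.PairwiseDisjoint fun b => ball b.1 b.2 :=
    hdisj.mono fun b => ball_subset_closedBall
  have hu : u.Countable := hdisj'.countable_of_isOpen (fun _ _ => isOpen_ball)
    fun b hb => nonempty_ball.2 (hpos b (huT hb))
  have hsub : {x | t < averageMaximal μ F g x} ⊆ ⋃ b ∈ u, ball b.1 (6 * b.2) := by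
    intro x hx
    obtain ⟨b, hb, hxb, h⟩ := lt_averageMaximal.1 hx
    obtain ⟨b', hb', h'⟩ := hcov b ⟨hb, h⟩
    have := hpos b' (huT hb')
    exact Set.mem_biUnion hb'
      (closedBall_subset_ball (by linarith) (h' (ball_subset_closedBall hxb)))
  have : Countable u := hu.to_subtype
  calc t * μ {x | t < averageMaximal μ F g x}
      ≤ t * ∑' b : u, μ (ball b.1.1 (6 * b.1.2)) := by
        gcongr
        exact (measure_mono hsub).trans (measure_biUnion_le μ hu _)
    _ = ∑' b : u, t * μ (ball b.1.1 (6 * b.1.2)) := ENNReal.tsum_mul_left.symm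
    _ ≤ ∑' b : u, D * ∫⁻ y in ball b.1.1 b.1.2, g y ∂μ := by
        refine ENNReal.tsum_le_tsum fun b => ?_
        calc t * μ (ball b.1.1 (6 * b.1.2)) ≤ t * (D * μ (ball b.1.1 b.1.2)) := by
              gcongr
              exact hD _ (huT b.2).1
          _ = D * (t * μ (ball b.1.1 b.1.2)) := by ring
          _ ≤ _ := by
              gcongr
              exact ENNReal.mul_le_of_le_div (huT b.2).2.le
    _ = D * ∫⁻ y in ⋃ b ∈ u, ball b.1 b.2, g y ∂μ := by
        rw [ENNReal.tsum_mul_left, lintegral_biUnion hu (fun _ _ => measurableSet_ball) hdisj']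
    _ ≤ D * ∫⁻ x, g x ∂μ := by
        gcongr
        exact Measure.restrict_le_self

/-- The pointwise layer-cake identity. Infinite values of `G` must be allowed, since maximal
functions may be infinite. -/
lemma lintegral_Ioi_indicator_lt_rpow (G : ℝ≥0∞) {s : ℝ} (hs : 0 < s) :
    ∫⁻ t in Set.Ioi (0 : ℝ), ({t | ENNReal.ofReal t < G} : Set ℝ).indicator
      (fun t => ENNReal.ofReal (t ^ (s - 1))) t = G ^ s / ENNReal.ofReal s := by
  have hfin : ∀ x : ℝ, 0 ≤ x → ∫⁻ t in Set.Ioi (0 : ℝ),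
      ({t | ENNReal.ofReal t < ENNReal.ofReal x} : Set ℝ).indicator
      (fun t => ENNReal.ofReal (t ^ (s - 1))) t = ENNReal.ofReal x ^ s / ENNReal.ofReal s := by
    intro x hx
    have hset : {t | ENNReal.ofReal t < ENNReal.ofReal x} ∩ Set.Ioi (0 : ℝ) = Set.Ioo 0 x := by
      ext t
      simp only [Set.mem_inter_iff, Set.mem_ofPred_eq, Set.mem_Ioi, Set.mem_Ioo]
      constructor
      · rintro ⟨h, ht⟩
        exact ⟨ht, (ENNReal.ofReal_lt_ofReal_iff_of_nonneg ht.le).1 h⟩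
      · rintro ⟨ht, h⟩
        exact ⟨(ENNReal.ofReal_lt_ofReal_iff_of_nonneg ht.le).2 h, ht⟩
    have hm : MeasurableSet {t : ℝ | ENNReal.ofReal t < ENNReal.ofReal x} :=
      measurableSet_lt ENNReal.measurable_ofReal measurable_const
    rw [lintegral_indicator hm, Measure.restrict_restrict hm, hset,
      restrict_Ioo_eq_restrict_Ioc, ← ofReal_integral_eq_lintegral_ofReal,
      ← intervalIntegral.integral_of_le hx, integral_rpow (Or.inl (by linarith)),
      ENNReal.ofReal_rpow_of_nonneg hx hs.le, sub_add_cancel, Real.zero_rpow hs.ne', sub_zero,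
      ENNReal.ofReal_div_of_pos hs]
    · exact (intervalIntegrable_iff_integrableOn_Ioc_of_le hx).1
        (intervalIntegral.intervalIntegrable_rpow' (by linarith))
    · exact (ae_restrict_mem measurableSet_Ioc).mono fun t ht => Real.rpow_nonneg ht.1.le _
  rcases eq_or_ne G ∞ with rfl | hG
  · rw [ENNReal.top_rpow_of_pos hs, ENNReal.top_div_of_ne_top ENNReal.ofReal_ne_top]
    refine ENNReal.eq_top_of_forall_nnreal_le fun r => ?_
    -- The truncation level at which the finite formula returns exactly `r`; as `r` is arbitrary,
    -- the integral is infinite.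
    set x : ℝ := (s * r) ^ (1 / s) with hx
    have hx0 : 0 ≤ x := by positivity
    have hval : ENNReal.ofReal x ^ s / ENNReal.ofReal s = r := by
      rw [ENNReal.ofReal_rpow_of_nonneg hx0 hs.le, hx, ← Real.rpow_mul (by positivity),
        one_div, inv_mul_cancel₀ hs.ne', Real.rpow_one, ← ENNReal.ofReal_div_of_pos hs,
        mul_div_cancel_left₀ _ hs.ne', ENNReal.ofReal_coe_nnreal]
    rw [← hval, ← hfin x hx0]
    refine lintegral_mono fun t => Set.indicator_le_indicator_of_subset ?_ (fun _ => zero_le) t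
    intro t ht
    exact lt_of_lt_of_le (show ENNReal.ofReal t < ENNReal.ofReal x from ht) le_top
  · simpa only [ENNReal.ofReal_toReal hG] using hfin G.toReal ENNReal.toReal_nonneg

lemma lintegral_rpow_div_eq_lintegral_meas_lt {X : Type*} [MeasurableSpace X] {μ : Measure X}
    [SFinite μ] {G : X → ℝ≥0∞}
    (hG : Measurable G) {s : ℝ} (hs : 0 < s) :
    ∫⁻ x, G x ^ s / ENNReal.ofReal s ∂μ =
      ∫⁻ t in Set.Ioi (0 : ℝ), ENNReal.ofReal (t ^ (s - 1)) * μ {x | ENNReal.ofReal t < G x} := by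
  have hm : MeasurableSet {z : X × ℝ | ENNReal.ofReal z.2 < G z.1} :=
    measurableSet_lt (by fun_prop) (by fun_prop)
  calc ∫⁻ x, G x ^ s / ENNReal.ofReal s ∂μ
      = ∫⁻ x, (∫⁻ t in Set.Ioi (0 : ℝ), ({t | ENNReal.ofReal t < G x} : Set ℝ).indicator
          (fun t => ENNReal.ofReal (t ^ (s - 1))) t) ∂μ := by
        simp_rw [lintegral_Ioi_indicator_lt_rpow _ hs]
    _ = ∫⁻ t in Set.Ioi (0 : ℝ), ∫⁻ x, ({t | ENNReal.ofReal t < G x} : Set ℝ).indicator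
          (fun t => ENNReal.ofReal (t ^ (s - 1))) t ∂μ := by
        refine lintegral_lintegral_swap (Measurable.aemeasurable ?_)
        exact Measurable.indicator (s := {z : X × ℝ | ENNReal.ofReal z.2 < G z.1})
          (f := fun z : X × ℝ => ENNReal.ofReal (z.2 ^ (s - 1))) (by fun_prop) hm
    _ = _ := by
        refine lintegral_congr fun t => ?_
        rw [← lintegral_indicator_const (measurableSet_lt measurable_const hG)]
        rfl

/-- The strong type `(q, q)` inequality, `1 < q < ∞`, for the maximal operator over a family of
balls on which the measure is doubling. -/
theorem lintegral_averageMaximal_rpow_le [OpensMeasurableSpace E]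
    [TopologicalSpace.SeparableSpace E] {μ : Measure E} [SFinite μ]
    {F : Set (E × ℝ)} {R : ℝ} (hR : ∀ b ∈ F, b.2 ≤ R) {D : ℝ≥0∞}
    (hD : ∀ b ∈ F, μ (ball b.1 (6 * b.2)) ≤ D * μ (ball b.1 b.2)) {q : ℝ} (hq : 1 < q)
    {g : E → ℝ≥0∞} (hg : AEMeasurable g μ) :
    ∫⁻ x, averageMaximal μ F g x ^ q ∂μ ≤
      ENNReal.ofReal (2 ^ q * q / (q - 1)) * D * ∫⁻ x, g x ^ q ∂μ := by
  wlog hgm : Measurable g generalizing g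
  · rw [averageMaximal_congr_ae hg.ae_eq_mk,
      lintegral_congr_ae (hg.ae_eq_mk.mono fun x hx => by simp only [hx] :
        (fun x => g x ^ q) =ᵐ[μ] fun x => hg.mk g x ^ q)]
    exact this hg.measurable_mk.aemeasurable hg.measurable_mk
  have hq0 : 0 < q := by linarith
  have hq1 : 0 < q - 1 := by linarith
  have hMm := measurable_averageMaximal μ F g
  -- Marcinkiewicz splitting at height `t / 2`: off `S t` the function is at most `t / 2`, so only
  -- its restriction to `S t` can push the maximal function above `t`. The weak type bound is
  -- applied to that restriction and integrated in `t`.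
  set S : ℝ → Set E := fun t => {x | ENNReal.ofReal t < 2 * g x} with hS
  have hSm : ∀ t, MeasurableSet (S t) := fun t => measurableSet_lt measurable_const (by fun_prop)
  have hSm2 : MeasurableSet {z : E × ℝ | ENNReal.ofReal z.2 < 2 * g z.1} :=
    measurableSet_lt (by fun_prop) (by fun_prop)
  have hweak : ∀ t : ℝ, 0 < t →
      ENNReal.ofReal (t ^ (q - 1)) * μ {x | ENNReal.ofReal t < averageMaximal μ F g x} ≤
        2 * D * (∫⁻ x, ENNReal.ofReal (t ^ (q - 1 - 1)) * (S t).indicator g x ∂μ) := by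
    intro t ht
    have hhalf : ENNReal.ofReal (t / 2) + ENNReal.ofReal (t / 2) = ENNReal.ofReal t := by
      rw [← ENNReal.ofReal_add (by positivity) (by positivity), add_halves]
    have hle : ∀ x, averageMaximal μ F g x ≤
        averageMaximal μ F ((S t).indicator g) x + ENNReal.ofReal (t / 2) := by
      intro x
      refine averageMaximal_le fun b hb hx => ?_
      calc (∫⁻ y in ball b.1 b.2, g y ∂μ) / μ (ball b.1 b.2)
          ≤ (∫⁻ y in ball b.1 b.2, ((S t).indicator g y + ENNReal.ofReal (t / 2)) ∂μ) /
            μ (ball b.1 b.2) := by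
            gcongr with y
            by_cases hy : y ∈ S t
            · simp [hy]
            · rw [Set.indicator_of_notMem hy, zero_add]
              have h2 : 2 * g y ≤ ENNReal.ofReal t := not_lt.1 hy
              rw [← hhalf, ← two_mul] at h2
              exact (ENNReal.mul_le_mul_iff_right (by simp) (by simp)).1 h2
        _ = (∫⁻ y in ball b.1 b.2, (S t).indicator g y ∂μ) / μ (ball b.1 b.2) +
            ENNReal.ofReal (t / 2) * μ (ball b.1 b.2) / μ (ball b.1 b.2) := by
            rw [lintegral_add_right _ measurable_const, setLIntegral_const, ENNReal.add_div]
        _ ≤ _ := by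
            gcongr
            · exact le_averageMaximal _ hb hx
            · exact ENNReal.div_le_of_le_mul le_rfl
    have hsub : {x | ENNReal.ofReal t < averageMaximal μ F g x} ⊆
        {x | ENNReal.ofReal (t / 2) < averageMaximal μ F ((S t).indicator g) x} := by
      intro x hx
      have := lt_of_lt_of_le hx (hle x)
      rw [← hhalf] at this
      exact lt_of_add_lt_add_right this
    have hw := mul_meas_lt_averageMaximal_le hR hD ((S t).indicator g) (ENNReal.ofReal (t / 2))
    have hpow : ENNReal.ofReal (t ^ (q - 1)) =
        ENNReal.ofReal (t ^ (q - 1 - 1)) * (2 * ENNReal.ofReal (t / 2)) := by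
      rw [two_mul, hhalf, ← ENNReal.ofReal_mul (by positivity), Real.rpow_sub_one ht.ne' (q - 1),
        div_mul_cancel₀ _ ht.ne']
    calc ENNReal.ofReal (t ^ (q - 1)) * μ {x | ENNReal.ofReal t < averageMaximal μ F g x}
        ≤ ENNReal.ofReal (t ^ (q - 1 - 1)) * (2 * ENNReal.ofReal (t / 2)) *
          μ {x | ENNReal.ofReal (t / 2) < averageMaximal μ F ((S t).indicator g) x} := by
          rw [hpow]; gcongr
      _ = 2 * ENNReal.ofReal (t ^ (q - 1 - 1)) * (ENNReal.ofReal (t / 2) *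
          μ {x | ENNReal.ofReal (t / 2) < averageMaximal μ F ((S t).indicator g) x}) := by ring
      _ ≤ 2 * ENNReal.ofReal (t ^ (q - 1 - 1)) * (D * ∫⁻ x, (S t).indicator g x ∂μ) := by gcongr
      _ = _ := by
          rw [lintegral_const_mul _ (hgm.indicator (hSm t))]; ring
  have hqr : ENNReal.ofReal q ≠ 0 := by simpa using hq0
  have key : ∫⁻ x, averageMaximal μ F g x ^ q / ENNReal.ofReal q ∂μ ≤
      2 * D * ∫⁻ x, g x * ((2 * g x) ^ (q - 1) / ENNReal.ofReal (q - 1)) ∂μ := by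
    rw [lintegral_rpow_div_eq_lintegral_meas_lt hMm hq0]
    calc _ ≤ ∫⁻ t in Set.Ioi (0 : ℝ), 2 * D *
            (∫⁻ x, ENNReal.ofReal (t ^ (q - 1 - 1)) * (S t).indicator g x ∂μ) :=
          setLIntegral_mono' measurableSet_Ioi fun t ht => hweak t ht
      _ = 2 * D * ∫⁻ t in Set.Ioi (0 : ℝ),
            (∫⁻ x, ENNReal.ofReal (t ^ (q - 1 - 1)) * (S t).indicator g x ∂μ) := by
          refine lintegral_const_mul'' _ ?_
          refine Measurable.aemeasurable ?_
          refine Measurable.lintegral_prod_left'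
            (f := fun z : E × ℝ => ENNReal.ofReal (z.2 ^ (q - 1 - 1)) * (S z.2).indicator g z.1) ?_
          refine Measurable.mul (by fun_prop) ?_
          exact Measurable.indicator (f := fun z : E × ℝ => g z.1) (by fun_prop) hSm2
      _ = 2 * D * ∫⁻ x, (∫⁻ t in Set.Ioi (0 : ℝ),
            ENNReal.ofReal (t ^ (q - 1 - 1)) * (S t).indicator g x) ∂μ := by
          congr 1
          refine lintegral_lintegral_swap (Measurable.aemeasurable ?_)
          refine Measurable.mul (by fun_prop) ?_
          exact Measurable.indicator (s := {z : ℝ × E | ENNReal.ofReal z.1 < 2 * g z.2})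
            (f := fun z : ℝ × E => g z.2) (by fun_prop)
            (measurableSet_lt (by fun_prop) (by fun_prop))
      _ = _ := by
          congr 1
          refine lintegral_congr fun x => ?_
          rw [← lintegral_Ioi_indicator_lt_rpow (2 * g x) hq1, ← lintegral_const_mul]
          · refine lintegral_congr fun t => ?_
            by_cases h : ENNReal.ofReal t < 2 * g x
            · rw [Set.indicator_of_mem (show x ∈ S t from h), Set.indicator_of_mem (by exact h),
                mul_comm]
            · rw [Set.indicator_of_notMem (show x ∉ S t from h),
                Set.indicator_of_notMem (by exact h)]
              simp
          · exact Measurable.indicator (by fun_prop)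
              (measurableSet_lt (by fun_prop) measurable_const)
  have hint : ∀ x, g x * ((2 * g x) ^ (q - 1) / ENNReal.ofReal (q - 1)) =
      2 ^ (q - 1) / ENNReal.ofReal (q - 1) * g x ^ q := by
    intro x
    have : g x ^ q = g x * g x ^ (q - 1) := by
      conv_rhs => rw [← ENNReal.rpow_one (g x), ← ENNReal.rpow_mul, one_mul]
      rw [← ENNReal.rpow_add_of_nonneg _ _ zero_le_one hq1.le]
      congr 1
      ring
    rw [this, ENNReal.mul_rpow_of_nonneg _ _ hq1.le, div_eq_mul_inv, div_eq_mul_inv]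
    ring
  have hconst : ENNReal.ofReal (2 ^ q * q / (q - 1)) =
      ENNReal.ofReal q * (2 * (2 ^ (q - 1) / ENNReal.ofReal (q - 1))) := by
    have h2 : (2 : ℝ≥0∞) = ENNReal.ofReal 2 := by simp
    rw [h2, ENNReal.ofReal_rpow_of_pos two_pos, ← ENNReal.ofReal_div_of_pos hq1,
      ← ENNReal.ofReal_mul (by norm_num), ← ENNReal.ofReal_mul hq0.le]
    congr 1
    rw [Real.rpow_sub_one two_ne_zero]
    field_simp
  simp_rw [hint, div_eq_mul_inv] at key
  rw [lintegral_mul_const _ (hMm.pow_const q), lintegral_const_mul _ (hgm.pow_const q),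
    ← div_eq_mul_inv, ← div_eq_mul_inv, ENNReal.div_le_iff hqr ENNReal.ofReal_ne_top] at key
  refine key.trans (le_of_eq ?_)
  rw [hconst]
  ring

end Maximal

/-! ### Weighted inequalities from Muckenhoupt conditions -/

section Muckenhoupt

variable {E : Type*} [MeasurableSpace E] {m : Measure E}

/-- The Muckenhoupt condition on a set `B'` implies doubling with respect to subsets of comparable
measure. -/
lemma setLIntegral_le_of_muckenhoupt {p q : ℝ} (hpq : p.HolderConjugate q) {U V : E → ℝ≥0∞}
    (hU : AEMeasurable U m) (hV : AEMeasurable V m)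
    (hUV : ∀ᵐ x ∂m, U x ^ (1 / p) * V x ^ (1 / q) = 1) {A D : ℝ≥0∞} (hA : A ≠ ∞)
    {B B' : Set E} (hBB' : B ⊆ B') (hB' : m B' ≠ ∞)
    (h : (∫⁻ x in B', U x ∂m) ^ (1 / p) * (∫⁻ x in B', V x ∂m) ^ (1 / q) ≤ A * m B')
    (hD : m B' ≤ D * m B) :
    ∫⁻ x in B', U x ∂m ≤ (A * D) ^ p * ∫⁻ x in B, U x ∂m := by
  have hp := hpq.pos
  have hq := hpq.symm.pos
  have hp' : 0 < 1 / p := by positivity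
  have hq' : 0 < 1 / q := by positivity
  by_cases hU0 : ∫⁻ x in B', U x ∂m = 0
  · simp [hU0]
  -- Otherwise `V` vanishes almost everywhere on `B'`, which contradicts `U^(1/p) V^(1/q) = 1`
  -- unless `B'` is null.
  have hV0 : ∫⁻ x in B', V x ∂m ≠ 0 := by
    intro h0
    apply hU0
    have h1 := (lintegral_eq_zero_iff' hV.restrict).1 h0
    have : ∀ᵐ x ∂(m.restrict B'), False := by
      filter_upwards [h1, ae_restrict_of_ae hUV] with x hx hx'
      rw [hx, Pi.zero_apply, ENNReal.zero_rpow_of_pos hq', mul_zero] at hx'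
      exact zero_ne_one hx'
    rw [ae_iff] at this
    simp only [not_false_eq_true, Set.ofPred_true, Measure.restrict_apply_univ] at this
    exact setLIntegral_measure_zero _ _ this
  have hVtop : ∫⁻ x in B', V x ∂m ≠ ∞ := by
    intro h0
    rw [h0, ENNReal.top_rpow_of_pos hq', ENNReal.mul_top
      (by rw [ne_eq, ENNReal.rpow_eq_zero_iff_of_pos hp']; exact hU0)] at h
    exact ENNReal.mul_ne_top hA hB' (top_le_iff.1 h)
  -- Hölder on the smaller set is the reverse of the Muckenhoupt inequality on `B'`. Comparing the
  -- two and cancelling the integral of `V` over `B'` gives the doubling.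
  have hholder : m B ≤ (∫⁻ x in B, U x ∂m) ^ (1 / p) * (∫⁻ x in B, V x ∂m) ^ (1 / q) := by
    calc m B = ∫⁻ x in B, U x ^ (1 / p) * V x ^ (1 / q) ∂m := by
          rw [lintegral_congr_ae (ae_restrict_of_ae hUV)]; simp
      _ ≤ _ := by
          refine (ENNReal.lintegral_mul_le_Lp_mul_Lq _ hpq (hU.restrict.pow_const _)
            (hV.restrict.pow_const _)).trans (le_of_eq ?_)
          simp_rw [← ENNReal.rpow_mul, one_div, inv_mul_cancel₀ hp.ne', inv_mul_cancel₀ hq.ne',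
            ENNReal.rpow_one]
  have key : (∫⁻ x in B', U x ∂m) ^ (1 / p) ≤ A * D * (∫⁻ x in B, U x ∂m) ^ (1 / p) := by
    refine (ENNReal.mul_le_mul_iff_left (c := (∫⁻ x in B', V x ∂m) ^ (1 / q)) ?_ ?_).1 ?_
    · rwa [ne_eq, ENNReal.rpow_eq_zero_iff_of_pos hq']
    · exact ENNReal.rpow_ne_top_of_nonneg hq'.le hVtop
    · calc _ ≤ A * m B' := h
        _ ≤ A * (D * ((∫⁻ x in B, U x ∂m) ^ (1 / p) * (∫⁻ x in B, V x ∂m) ^ (1 / q))) := by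
            gcongr; exact hD.trans (by gcongr)
        _ ≤ A * (D * ((∫⁻ x in B, U x ∂m) ^ (1 / p) * (∫⁻ x in B', V x ∂m) ^ (1 / q))) := by
            gcongr
        _ = _ := by ring
  have := ENNReal.rpow_le_rpow key hp.le
  rwa [ENNReal.mul_rpow_of_nonneg _ _ hp.le, ← ENNReal.rpow_mul, ← ENNReal.rpow_mul, one_div,
    inv_mul_cancel₀ hp.ne', ENNReal.rpow_one, ENNReal.rpow_one] at this

variable [PseudoMetricSpace E] [OpensMeasurableSpace E] [TopologicalSpace.SeparableSpace E]

/-- Muckenhoupt's theorem for the maximal operator over a family of balls: a weight satisfying the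
`A_p` condition on the balls of the family and on their enlargements yields a weighted strong type
inequality. -/
theorem exists_lintegral_averageMaximal_rpow_mul_le [SFinite m] {p q : ℝ}
    (hpq : p.HolderConjugate q) {U : E → ℝ≥0∞} (hU : AEMeasurable U m)
    (hU0 : ∀ᵐ x ∂m, U x ≠ 0) (hUtop : ∀ᵐ x ∂m, U x ≠ ∞) {A D : ℝ≥0∞} (hA : A ≠ ∞) (hD : D ≠ ∞) :
    ∃ C : ℝ≥0∞, C ≠ ∞ ∧ ∀ (F : Set (E × ℝ)) (R : ℝ), (∀ b ∈ F, b.2 ≤ R) → (∀ b ∈ F, 0 < b.2) →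
      (∀ b ∈ F, m (ball b.1 b.2) ≠ 0) → (∀ b ∈ F, m (ball b.1 (6 * b.2)) ≠ ∞) →
      (∀ b ∈ F, m (ball b.1 (6 * b.2)) ≤ D * m (ball b.1 b.2)) →
      (∀ b ∈ F, ∀ k ∈ ({1, 6} : Set ℝ), (∫⁻ x in ball b.1 (k * b.2), U x ∂m) ^ (1 / p) *
        (∫⁻ x in ball b.1 (k * b.2), U x ^ (1 - q) ∂m) ^ (1 / q) ≤ A * m (ball b.1 (k * b.2))) →
      ∀ f : E → ℝ≥0∞, AEMeasurable f m →
        ∫⁻ x, averageMaximal m F f x ^ p * U x ∂m ≤ C * ∫⁻ x, f x ^ p * U x ∂m := by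
  have hp := hpq.pos
  have hq := hpq.symm.pos
  have hp1 : 0 < p - 1 := by linarith [hpq.lt]
  have hpq1 : (p - 1) * q = p := hpq.sub_one_mul_conj
  -- This makes the relation between `U` and `V = U^(1 - q)` symmetric: `U = V^(1 - p)`.
  have hpq2 : (1 - q) * (1 - p) = 1 := by linarith [hpq.mul_eq_add]
  set V : E → ℝ≥0∞ := fun x => U x ^ (1 - q) with hVdef
  have hV : AEMeasurable V m := hU.pow_const _
  have hUVae : ∀ᵐ x ∂m, U x ^ (1 / p) * V x ^ (1 / q) = 1 := by
    filter_upwards [hU0, hUtop] with x h0 ht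
    rw [hVdef, ← ENNReal.rpow_mul, ← ENNReal.rpow_add _ _ h0 ht]
    have : 1 / p + (1 - q) * (1 / q) = 0 := by
      have := hpq.inv_add_inv_eq_one
      field_simp at this ⊢
      linarith
    rw [this, ENNReal.rpow_zero]
  have hV0 : ∀ᵐ x ∂m, V x ≠ 0 := by
    filter_upwards [hU0, hUtop] with x h0 ht
    exact (ENNReal.rpow_pos (pos_iff_ne_zero.2 h0) ht).ne'
  have hVtop : ∀ᵐ x ∂m, V x ≠ ∞ := by
    filter_upwards [hU0, hUtop] with x h0 ht
    exact ENNReal.rpow_ne_top_of_ne_zero h0 ht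
  set μ := m.withDensity U with hμ
  set ν := m.withDensity V with hν
  refine ⟨(A ^ p) ^ q * (ENNReal.ofReal (2 ^ q * q / (q - 1)) * (A * D) ^ p *
    (ENNReal.ofReal (2 ^ p * p / (p - 1)) * (A * D) ^ q)), ?_, ?_⟩
  · have h1 : (A * D) ≠ ∞ := ENNReal.mul_ne_top hA hD
    have h2 := ENNReal.rpow_ne_top_of_nonneg hp.le h1
    have h3 := ENNReal.rpow_ne_top_of_nonneg hq.le h1
    have h4 := ENNReal.rpow_ne_top_of_nonneg hq.le (ENNReal.rpow_ne_top_of_nonneg hp.le hA)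
    finiteness
  intro F R hR hpos hm0 hmtop hmD hAp f hf
  have hballsub : ∀ b ∈ F, ball b.1 b.2 ⊆ ball b.1 (6 * b.2) := fun b hb =>
    ball_subset_ball (by linarith [hpos b hb])
  have hμD : ∀ b ∈ F, μ (ball b.1 (6 * b.2)) ≤ (A * D) ^ p * μ (ball b.1 b.2) := by
    intro b hb
    rw [hμ, withDensity_apply _ measurableSet_ball, withDensity_apply _ measurableSet_ball]
    exact setLIntegral_le_of_muckenhoupt hpq hU hV hUVae hA (hballsub b hb) (hmtop b hb)
      (hAp b hb 6 (by simp)) (hmD b hb)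
  have hνD : ∀ b ∈ F, ν (ball b.1 (6 * b.2)) ≤ (A * D) ^ q * ν (ball b.1 b.2) := by
    intro b hb
    rw [hν, withDensity_apply _ measurableSet_ball, withDensity_apply _ measurableSet_ball]
    refine setLIntegral_le_of_muckenhoupt hpq.symm hV hU ?_ hA (hballsub b hb) (hmtop b hb)
      ?_ (hmD b hb)
    · simpa only [mul_comm] using hUVae
    · rw [mul_comm]; exact hAp b hb 6 (by simp)
  -- Lerner's construction: `h` turns `f dm` into `h dν`, and `G` turns `N^(p-1) dm` into `G dμ`,
  -- where `N` is the maximal function of `h` with respect to `ν`. Both measures are doubling on the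
  -- family, so the two maximal operators are bounded on `L^p(ν)` and `L^q(μ)`.
  set h : E → ℝ≥0∞ := fun x => f x / V x with hh
  have hhm : AEMeasurable h m := hf.div hV
  set N := averageMaximal ν F h with hN
  have hNm : Measurable N := measurable_averageMaximal _ _ _
  set G : E → ℝ≥0∞ := fun x => N x ^ (p - 1) / U x with hG
  have hGm : AEMeasurable G m := (hNm.pow_const _).aemeasurable.div hU
  have hUac : μ ≪ m := withDensity_absolutelyContinuous _ _
  have hVac : ν ≪ m := withDensity_absolutelyContinuous _ _
  -- With `J` the `ν`-average of `h` on `B`, the `m`-average of `f` is `J ν(B) / m(B)`. The `p`-th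
  -- power of the `A_p` condition bounds its power `p - 1` by `A^p m(B) J^(p-1) / μ(B)`, and `J ≤ N`
  -- on `B` turns this into `A^p` times the `μ`-average of `G`.
  have hpoint : ∀ x, averageMaximal m F f x ^ p ≤ (A ^ p) ^ q * averageMaximal μ F G x ^ q := by
    intro x
    have hle : averageMaximal m F f x ≤ (A ^ p * averageMaximal μ F G x) ^ (1 / (p - 1)) := by
      refine averageMaximal_le fun b hb hx => ?_
      set B := ball b.1 b.2 with hB
      have hBm : MeasurableSet B := measurableSet_ball
      have hmB0 : m B ≠ 0 := hm0 b hb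
      have hmBtop : m B ≠ ∞ := ne_top_of_le_ne_top (hmtop b hb) (measure_mono (hballsub b hb))
      have hApB : μ B ^ (1 / p) * ν B ^ (1 / q) ≤ A * m B := by
        have := hAp b hb 1 (by simp)
        rwa [one_mul, ← withDensity_apply _ measurableSet_ball,
          ← withDensity_apply _ measurableSet_ball] at this
      have hmμ : m ≪ μ := withDensity_absolutelyContinuous' hU hU0
      have hmν : m ≪ ν := withDensity_absolutelyContinuous' hV hV0
      have hμ0 : μ B ≠ 0 := fun h0 => hmB0 (hmμ h0)
      have hν0 : ν B ≠ 0 := fun h0 => hmB0 (hmν h0)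
      have htop : A * m B ≠ ∞ := ENNReal.mul_ne_top hA hmBtop
      have hμtop : μ B ≠ ∞ := by
        intro h0
        rw [h0, ENNReal.top_rpow_of_pos (by positivity), ENNReal.top_mul
          (by rwa [ne_eq, ENNReal.rpow_eq_zero_iff_of_pos (by positivity)])] at hApB
        exact htop (top_le_iff.1 hApB)
      have hνtop : ν B ≠ ∞ := by
        intro h0
        rw [h0, ENNReal.top_rpow_of_pos (by positivity), ENNReal.mul_top
          (by rwa [ne_eq, ENNReal.rpow_eq_zero_iff_of_pos (by positivity)])] at hApB
        exact htop (top_le_iff.1 hApB)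
      have hint : ∫⁻ y in B, f y ∂m = ∫⁻ y in B, h y ∂ν := by
        rw [hν, setLIntegral_withDensity_eq_lintegral_mul₀' hV (hhm.mono_ac hVac) hBm]
        refine lintegral_congr_ae (ae_restrict_of_ae ?_)
        filter_upwards [hV0, hVtop] with y h0 ht
        rw [Pi.mul_apply, hh, ENNReal.mul_div_cancel h0 ht]
      set J := (∫⁻ y in B, h y ∂ν) / ν B with hJ
      have hJB : ∫⁻ y in B, h y ∂ν = J * ν B := (ENNReal.div_mul_cancel hν0 hνtop).symm
      have hGint : m B * J ^ (p - 1) ≤ ∫⁻ y in B, G y ∂μ := by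
        calc m B * J ^ (p - 1) = ∫⁻ y in B, J ^ (p - 1) ∂m := by
              rw [setLIntegral_const, mul_comm]
          _ ≤ ∫⁻ y in B, N y ^ (p - 1) ∂m := by
              refine setLIntegral_mono' hBm fun y hy => ?_
              gcongr
              exact le_averageMaximal h hb hy
          _ = ∫⁻ y in B, G y ∂μ := by
              rw [hμ, setLIntegral_withDensity_eq_lintegral_mul₀' hU (hGm.mono_ac hUac) hBm]
              refine lintegral_congr_ae (ae_restrict_of_ae ?_)
              filter_upwards [hU0, hUtop] with y h0 ht
              rw [Pi.mul_apply, hG, ENNReal.mul_div_cancel h0 ht]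
      have hAp' : ν B ^ (p - 1) ≤ A ^ p * m B ^ p / μ B := by
        rw [ENNReal.le_div_iff_mul_le (Or.inl hμ0) (Or.inl hμtop)]
        have := ENNReal.rpow_le_rpow hApB hp.le
        rw [ENNReal.mul_rpow_of_nonneg _ _ hp.le, ENNReal.mul_rpow_of_nonneg _ _ hp.le,
          ← ENNReal.rpow_mul, ← ENNReal.rpow_mul, one_div, inv_mul_cancel₀ hp.ne',
          ENNReal.rpow_one] at this
        have hexp : 1 / q * p = p - 1 := by
          rw [one_div, inv_mul_eq_div, div_eq_iff hq.ne', hpq1]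
        rwa [hexp, mul_comm] at this
      have hmBp : m B ^ p = m B ^ (p - 1) * m B := by
        conv_rhs => rw [← ENNReal.rpow_one (m B), ← ENNReal.rpow_mul, one_mul,
          ← ENNReal.rpow_add _ _ hmB0 hmBtop]
        simp
      have hmBp0 : m B ^ (p - 1) ≠ 0 := by
        rwa [ne_eq, ENNReal.rpow_eq_zero_iff_of_pos hp1]
      have hmBptop : m B ^ (p - 1) ≠ ∞ := ENNReal.rpow_ne_top_of_nonneg hp1.le hmBtop
      rw [one_div, ENNReal.le_rpow_inv_iff hp1, hint, hJB,
        ENNReal.div_rpow_of_nonneg _ _ hp1.le, ENNReal.mul_rpow_of_nonneg _ _ hp1.le]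
      calc J ^ (p - 1) * ν B ^ (p - 1) / m B ^ (p - 1)
          ≤ J ^ (p - 1) * (A ^ p * m B ^ p / μ B) / m B ^ (p - 1) := by gcongr
        _ = A ^ p * ((m B * J ^ (p - 1)) / μ B) * (m B ^ (p - 1) * (m B ^ (p - 1))⁻¹) := by
            rw [hmBp]; simp only [div_eq_mul_inv]; ring
        _ = A ^ p * ((m B * J ^ (p - 1)) / μ B) := by
            rw [ENNReal.mul_inv_cancel hmBp0 hmBptop, mul_one]
        _ ≤ A ^ p * averageMaximal μ F G x := by
            gcongr
            exact (ENNReal.div_le_div_right hGint _).trans (le_averageMaximal G hb hx)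
    calc averageMaximal m F f x ^ p
        ≤ ((A ^ p * averageMaximal μ F G x) ^ (1 / (p - 1))) ^ p := by gcongr
      _ = (A ^ p * averageMaximal μ F G x) ^ q := by
          rw [← ENNReal.rpow_mul]
          congr 1
          field_simp
          linarith
      _ = _ := ENNReal.mul_rpow_of_nonneg _ _ hq.le
  -- The exponents match because `(p - 1) q = p` and `U^(1 - q) = V`.
  have hGq : ∫⁻ x, G x ^ q ∂μ = ∫⁻ x, N x ^ p ∂ν := by
    rw [hμ, hν, lintegral_withDensity_eq_lintegral_mul₀' hU ((hGm.mono_ac hUac).pow_const q),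
      lintegral_withDensity_eq_lintegral_mul₀' hV (hNm.pow_const p).aemeasurable]
    refine lintegral_congr_ae ?_
    filter_upwards [hU0, hUtop] with x h0 ht
    simp only [Pi.mul_apply, hG, hVdef]
    rw [ENNReal.div_rpow_of_nonneg _ _ hq.le, ← ENNReal.rpow_mul, hpq1, ENNReal.rpow_sub _ _ h0 ht,
      ENNReal.rpow_one, div_eq_mul_inv, div_eq_mul_inv]
    ring
  have hhp : ∫⁻ x, h x ^ p ∂ν = ∫⁻ x, f x ^ p * U x ∂m := by
    rw [hν, lintegral_withDensity_eq_lintegral_mul₀' hV ((hhm.mono_ac hVac).pow_const p)]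
    refine lintegral_congr_ae ?_
    filter_upwards [hU0, hUtop, hV0, hVtop] with x h0 ht h0' ht'
    have hVU : V x ^ (1 - p) = U x := by
      rw [hVdef, ← ENNReal.rpow_mul, hpq2, ENNReal.rpow_one]
    rw [ENNReal.rpow_sub _ _ h0' ht', ENNReal.rpow_one] at hVU
    simp only [Pi.mul_apply, hh]
    rw [← hVU, ENNReal.div_rpow_of_nonneg _ _ hp.le, div_eq_mul_inv, div_eq_mul_inv]
    ring
  calc ∫⁻ x, averageMaximal m F f x ^ p * U x ∂m
      = ∫⁻ x, averageMaximal m F f x ^ p ∂μ := by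
        rw [hμ, lintegral_withDensity_eq_lintegral_mul₀' hU
          ((measurable_averageMaximal m F f).pow_const p).aemeasurable]
        simp only [Pi.mul_apply, mul_comm]
    _ ≤ ∫⁻ x, (A ^ p) ^ q * averageMaximal μ F G x ^ q ∂μ := lintegral_mono hpoint
    _ = (A ^ p) ^ q * ∫⁻ x, averageMaximal μ F G x ^ q ∂μ :=
        lintegral_const_mul _ ((measurable_averageMaximal μ F G).pow_const q)
    _ ≤ (A ^ p) ^ q * (ENNReal.ofReal (2 ^ q * q / (q - 1)) * (A * D) ^ p * ∫⁻ x, G x ^ q ∂μ) := by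
        gcongr
        exact lintegral_averageMaximal_rpow_le hR hμD hpq.symm.lt (hGm.mono_ac hUac)
    _ ≤ (A ^ p) ^ q * (ENNReal.ofReal (2 ^ q * q / (q - 1)) * (A * D) ^ p *
        (ENNReal.ofReal (2 ^ p * p / (p - 1)) * (A * D) ^ q * ∫⁻ x, h x ^ p ∂ν)) := by
        rw [hGq]
        gcongr
        exact lintegral_averageMaximal_rpow_le hR hνD hpq.lt (hhm.mono_ac hVac)
    _ = _ := by rw [hhp]; ring

/-- The weak type inequality for the maximal operator over a family of balls, for a weight
satisfying the `A_1` condition on the balls of the family and on their enlargements. -/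
theorem mul_lintegral_lt_averageMaximal_le {U : E → ℝ≥0∞} (hU : AEMeasurable U m)
    (hU0 : ∀ᵐ x ∂m, U x ≠ 0) {A D : ℝ≥0∞} {F : Set (E × ℝ)} {R : ℝ}
    (hR : ∀ b ∈ F, b.2 ≤ R) (hpos : ∀ b ∈ F, 0 < b.2)
    (hm0 : ∀ b ∈ F, m (ball b.1 b.2) ≠ 0) (hmtop : ∀ b ∈ F, m (ball b.1 b.2) ≠ ∞)
    (hmD : ∀ b ∈ F, m (ball b.1 (6 * b.2)) ≤ D * m (ball b.1 b.2))
    (hUtop : ∀ b ∈ F, ∫⁻ x in ball b.1 b.2, U x ∂m ≠ ∞)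
    (hA1 : ∀ b ∈ F, ∀ k ∈ ({1, 6} : Set ℝ), ∀ᵐ x ∂(m.restrict (ball b.1 (k * b.2))),
      ∫⁻ y in ball b.1 (k * b.2), U y ∂m ≤ A * m (ball b.1 (k * b.2)) * U x)
    {f : E → ℝ≥0∞} (hf : AEMeasurable f m) (t : ℝ≥0∞) :
    t * ∫⁻ x in {x | t < averageMaximal m F f x}, U x ∂m ≤
      A * D * A * ∫⁻ x, f x * U x ∂m := by
  set μ := m.withDensity U with hμ
  have hμball : ∀ (x : E) (r : ℝ), μ (ball x r) = ∫⁻ y in ball x r, U y ∂m := fun x r =>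
    withDensity_apply _ measurableSet_ball
  -- Integrate the `A_1` inequality of the enlarged ball over the original one.
  have hμD : ∀ b ∈ F, μ (ball b.1 (6 * b.2)) ≤ A * D * μ (ball b.1 b.2) := by
    intro b hb
    have hsub : ball b.1 b.2 ⊆ ball b.1 (6 * b.2) := ball_subset_ball (by linarith [hpos b hb])
    have h1 : ∀ᵐ x ∂(m.restrict (ball b.1 b.2)), μ (ball b.1 (6 * b.2)) ≤
        A * m (ball b.1 (6 * b.2)) * U x := by
      rw [hμball]
      exact ae_restrict_of_ae_restrict_of_subset hsub (hA1 b hb 6 (by simp))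
    have h2 := lintegral_mono_ae h1
    rw [setLIntegral_const, lintegral_const_mul'' _ hU.restrict, ← hμball] at h2
    refine (ENNReal.mul_le_mul_iff_left (hm0 b hb) (hmtop b hb)).1 (h2.trans ?_)
    calc A * m (ball b.1 (6 * b.2)) * μ (ball b.1 b.2)
        ≤ A * (D * m (ball b.1 b.2)) * μ (ball b.1 b.2) := by gcongr; exact hmD b hb
      _ = _ := by ring
  -- Multiplying the `A_1` inequality by `f` and integrating compares each `m`-average of `f` with a
  -- `μ`-average of `A f`, so the unweighted-type weak bound for `μ` suffices.
  have hle : ∀ x, averageMaximal m F f x ≤ averageMaximal μ F (fun y => A * f y) x := by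
    intro x
    refine averageMaximal_le fun b hb hx => le_trans ?_ (le_averageMaximal _ hb hx)
    have hμ0 : μ (ball b.1 b.2) ≠ 0 := fun h0 =>
      hm0 b hb (withDensity_absolutelyContinuous' hU hU0 h0)
    have hμtop : μ (ball b.1 b.2) ≠ ∞ := by rw [hμball]; exact hUtop b hb
    have hfU : ∫⁻ y in ball b.1 b.2, A * f y ∂μ = ∫⁻ y in ball b.1 b.2, U y * (A * f y) ∂m := by
      rw [hμ, setLIntegral_withDensity_eq_lintegral_mul₀ hU (hf.const_mul A) measurableSet_ball]
      rfl
    rw [ENNReal.le_div_iff_mul_le (Or.inl hμ0) (Or.inl hμtop), hfU, ← ENNReal.mul_div_right_comm]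
    refine ENNReal.div_le_of_le_mul ?_
    rw [← lintegral_mul_const'' _ hf.restrict, ← lintegral_mul_const'' _
      (f := fun y => U y * (A * f y)) (hU.mul (hf.const_mul A)).restrict]
    have h1 := hA1 b hb 1 (by simp)
    rw [one_mul, ← hμball] at h1
    refine lintegral_mono_ae ?_
    filter_upwards [h1] with y hy
    calc f y * μ (ball b.1 b.2) ≤ f y * (A * m (ball b.1 b.2) * U y) := by gcongr
      _ = _ := by ring
  have hopen := isOpen_lt_averageMaximal m F f t
  calc t * ∫⁻ x in {x | t < averageMaximal m F f x}, U x ∂m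
      = t * μ {x | t < averageMaximal m F f x} := by
        rw [hμ, withDensity_apply _ hopen.measurableSet]
    _ ≤ t * μ {x | t < averageMaximal μ F (fun y => A * f y) x} := by
        gcongr with x
        exact hle x
    _ ≤ A * D * ∫⁻ x, A * f x ∂μ := mul_meas_lt_averageMaximal_le hR hμD _ t
    _ = _ := by
        rw [hμ, lintegral_withDensity_eq_lintegral_mul₀ hU (hf.const_mul A),
          mul_assoc (A * D) A, ← lintegral_const_mul'' _ (f := fun x => f x * U x) (hf.mul hU)]
        congr 1
        refine lintegral_congr fun x => ?_
        simp only [Pi.mul_apply]; ring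

end Muckenhoupt

/-! ### From local balls to all balls -/

/-- Volume ratios are `n`-th powers of radius ratios, so each halving of the radius gains `θ =
2^(-nδ)`. Positivity of `n` is what makes `θ < 1`. -/
lemma IsReverseDoubling.exists_le_half_pow {n : ℕ} (hn : 0 < n) {φ : Rn n → ℝ → ℝ}
    (hφ : IsPositiveOnBalls φ) (h : IsReverseDoubling φ) :
    ∃ C θ : ℝ, 0 ≤ C ∧ 0 < θ ∧ θ < 1 ∧ ∀ (c₁ : Rn n) (r₁ : ℝ) (c₂ : Rn n) (r₂ : ℝ) (j : ℕ),
      0 < r₁ → 0 < r₂ → r₁ ≤ (1 / 2) ^ j * r₂ → ball c₁ r₁ ⊆ ball c₂ r₂ →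
        φ c₁ r₁ ≤ C * θ ^ j * φ c₂ r₂ := by
  obtain ⟨δ, hδ, C, hC⟩ := h
  refine ⟨max C 0, ((1 / 2 : ℝ) ^ n) ^ δ, le_max_right _ _, by positivity, ?_, ?_⟩
  · exact Real.rpow_lt_one (by positivity) (pow_lt_one₀ (by norm_num) (by norm_num) hn.ne') hδ
  intro c₁ r₁ c₂ r₂ j hr₁ hr₂ hle hsub
  have h1 := hC c₁ r₁ c₂ r₂ hr₁ hr₂ hsub
  have hφ₂ := hφ c₂ r₂ hr₂
  rw [div_le_iff₀ hφ₂] at h1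
  refine h1.trans ?_
  have hv : 0 < volume.real (ball (0 : Rn n) 1) :=
    ENNReal.toReal_pos (measure_ball_pos _ _ one_pos).ne' measure_ball_lt_top.ne
  have hratio : volume.real (ball c₁ r₁) / volume.real (ball c₂ r₂) = (r₁ / r₂) ^ n := by
    have hball : ∀ (c : Rn n) {r : ℝ}, 0 < r →
        volume.real (ball c r) = r ^ n * volume.real (ball (0 : Rn n) 1) := by
      intro c r hr
      rw [measureReal_def, Measure.addHaar_ball_of_pos _ _ hr, finrank_euclideanSpace_fin,
        ENNReal.toReal_mul, ENNReal.toReal_ofReal (by positivity), measureReal_def]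
    rw [hball c₁ hr₁, hball c₂ hr₂, div_pow]
    field_simp
  have hpow : ((r₁ / r₂) ^ n) ^ δ ≤ (((1 / 2 : ℝ) ^ n) ^ δ) ^ j := by
    have : (((1 / 2 : ℝ) ^ n) ^ δ) ^ j = (((1 / 2 : ℝ) ^ j) ^ n) ^ δ := by
      rw [← Real.rpow_natCast _ j, ← Real.rpow_mul (by positivity), mul_comm δ,
        Real.rpow_mul (by positivity), Real.rpow_natCast, pow_right_comm]
    rw [this]
    gcongr
    rwa [div_le_iff₀ hr₂]
  rw [hratio]
  gcongr
  exact le_max_left _ _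

lemma IsDoubling.exists_le_pow {n : ℕ} {φ : Rn n → ℝ → ℝ} (hφ : IsPositiveOnBalls φ)
    (h : IsDoubling φ) :
    ∃ C : ℝ, 0 ≤ C ∧ ∀ (c : Rn n) (r : ℝ) (k : ℕ), 0 < r → φ c (2 ^ k * r) ≤ C ^ k * φ c r := by
  obtain ⟨C, hC⟩ := h
  refine ⟨max C 0, le_max_right _ _, fun c r k hr => ?_⟩
  induction k with
  | zero => simp
  | succ k ih =>
    have hpos := hφ c (2 ^ k * r) (by positivity)
    calc φ c (2 ^ (k + 1) * r) = φ c (2 * (2 ^ k * r)) := by ring_nf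
      _ ≤ C * φ c (2 ^ k * r) := hC _ _ (by positivity)
      _ ≤ max C 0 * φ c (2 ^ k * r) := by gcongr; exact le_max_left _ _
      _ ≤ max C 0 * (max C 0 ^ k * φ c r) := by gcongr
      _ = _ := by ring

/-- Compactness of the closed annulus `1/2 ≤ ‖y‖ ≤ 1` and scaling: one finite set of centers serves
every `ρ`, so the number of covering balls is independent of the scale. -/
lemma exists_finset_annulus_subset {n : ℕ} (a : Rn n) {s : ℝ} (hs : 0 < s) :
    ∃ S : Finset (Rn n), (∀ y ∈ S, 1 / 2 ≤ ‖y‖ ∧ ‖y‖ ≤ 1) ∧ ∀ ρ : ℝ, 0 < ρ → ∀ x : Rn n,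
      ρ / 2 ≤ ‖x - a‖ → ‖x - a‖ ≤ ρ → ∃ y ∈ S, x ∈ ball (a + ρ • y) (ρ * s) := by
  have hcomp : IsCompact {y : Rn n | 1 / 2 ≤ ‖y‖ ∧ ‖y‖ ≤ 1} := by
    refine (isCompact_closedBall (0 : Rn n) 1).of_isClosed_subset ?_ ?_
    · exact (isClosed_le continuous_const continuous_norm).inter
        (isClosed_le continuous_norm continuous_const)
    · intro y hy
      simpa using hy.2
  obtain ⟨t, ht, htfin, hcov⟩ := hcomp.finite_cover_balls hs
  refine ⟨htfin.toFinset, fun y hy => ht (by simpa using hy), fun ρ hρ x h1 h2 => ?_⟩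
  have hmem : ρ⁻¹ • (x - a) ∈ {y : Rn n | 1 / 2 ≤ ‖y‖ ∧ ‖y‖ ≤ 1} := by
    have : ‖ρ⁻¹ • (x - a)‖ = ‖x - a‖ / ρ := by
      rw [norm_smul, norm_inv, Real.norm_of_nonneg hρ.le, inv_mul_eq_div]
    constructor
    · rw [this, le_div_iff₀ hρ]; linarith
    · rw [this, div_le_iff₀ hρ]; linarith
  obtain ⟨y, hy, hxy⟩ := Set.mem_iUnion₂.1 (hcov hmem)
  refine ⟨y, by simpa using hy, ?_⟩
  rw [mem_ball, dist_eq_norm] at hxy ⊢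
  have : x - (a + ρ • y) = ρ • (ρ⁻¹ • (x - a) - y) := by
    rw [smul_sub, smul_inv_smul₀ hρ.ne']; abel
  rw [this, norm_smul, Real.norm_of_nonneg hρ.le]
  gcongr

/-- A bound of a measure by `φ` on the balls which are small compared with their distance to `a`
propagates to all balls. -/
theorem exists_measure_ball_le_of_local {n : ℕ} (hn : 0 < n) {φ : Rn n → ℝ → ℝ}
    (hφ : IsPositiveOnBalls φ) (hd : IsDoubling φ) (hr : IsReverseDoubling φ) (a : Rn n) {ε : ℝ}
    (hε : 0 < ε) :
    ∃ C : ℝ≥0∞, C ≠ ∞ ∧ ∀ T : Measure (Rn n), T ≪ volume → ∀ K : ℝ≥0∞,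
      (∀ c r, 0 < r → r < ε * ‖c - a‖ → T (ball c r) ≤ K * ENNReal.ofReal (φ c r)) →
      ∀ c r, 0 < r → T (ball c r) ≤ C * K * ENNReal.ofReal (φ c r) := by
  obtain ⟨C₁, θ, hC₁, hθ0, hθ1, hrev⟩ := hr.exists_le_half_pow hn hφ
  obtain ⟨C₂, hC₂, hdoub⟩ := hd.exists_le_pow hφ
  -- The centers in the annulus of outer radius `ρ` are at distance at least `ρ / 2` from `a`, so `s
  -- ≤ ε / 4` makes balls of radius `ρ s` local; `s ≤ 1` keeps them within `2ρ` of `a`.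
  set s : ℝ := min (ε / 4) 1 with hs
  have hs0 : 0 < s := by positivity
  have hs1 : s ≤ 1 := min_le_right _ _
  have hs2 : s ≤ ε / 4 := min_le_left _ _
  obtain ⟨S, hS, hcov⟩ := exists_finset_annulus_subset a hs0
  -- For a nonlocal ball `‖c - a‖ ≤ r / ε`; this `k` is large enough for `B(c, 2^k r)` to contain
  -- all the covering balls.
  obtain ⟨k, hk⟩ := pow_unbounded_of_one_lt (3 + 4 / ε) (one_lt_two (α := ℝ))
  refine ⟨1 + S.card * ENNReal.ofReal (C₁ * C₂ ^ k) * (1 - ENNReal.ofReal θ)⁻¹, ?_, ?_⟩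
  · have : 1 - ENNReal.ofReal θ ≠ 0 := by
      rw [ne_eq, tsub_eq_zero_iff_le, not_le]
      simpa using hθ1
    finiteness
  intro T hT K hK c r hr
  by_cases hloc : r < ε * ‖c - a‖
  · refine (hK c r hr hloc).trans ?_
    gcongr
    nth_rewrite 1 [← one_mul K]
    gcongr
    exact le_self_add
  rw [not_lt] at hloc
  have hca : ‖c - a‖ ≤ r / ε := by rwa [le_div_iff₀ hε, mul_comm]
  have hrε : 0 < r / ε := by positivity
  set ρ : ℝ := ‖c - a‖ + r with hρ
  have hρ0 : 0 < ρ := by positivity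
  have hM : 3 * r + 4 * (r / ε) ≤ 2 ^ k * r := by
    have := mul_le_mul_of_nonneg_right hk.le hr.le
    calc 3 * r + 4 * (r / ε) = (3 + 4 / ε) * r := by ring
      _ ≤ _ := this
  set ρj : ℕ → ℝ := fun j => (1 / 2) ^ j * ρ with hρj
  have hρj0 : ∀ j, 0 < ρj j := fun j => by positivity
  have hρjle : ∀ j, ρj j ≤ ρ := fun j =>
    mul_le_of_le_one_left hρ0.le (pow_le_one₀ (by norm_num) (by norm_num))
  have hpiece : ∀ j, ∀ y ∈ S, T (ball (a + ρj j • y) (ρj j * s)) ≤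
      K * ENNReal.ofReal (C₁ * C₂ ^ k) * ENNReal.ofReal (φ c r) * ENNReal.ofReal θ ^ j := by
    intro j y hy
    obtain ⟨hy1, hy2⟩ := hS y hy
    have hpos := hρj0 j
    have hnorm : ‖ρj j • y‖ = ρj j * ‖y‖ := by rw [norm_smul, Real.norm_of_nonneg hpos.le]
    refine (hK _ _ (by positivity) ?_).trans ?_
    · rw [add_sub_cancel_left, hnorm]
      calc ρj j * s < ρj j * (ε * (1 / 2)) := by gcongr; linarith
        _ ≤ ρj j * (ε * ‖y‖) := by gcongr
        _ = _ := by ring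
    · have hle : ρj j * s ≤ (1 / 2) ^ j * (2 ^ k * r) := by
        calc ρj j * s ≤ ρj j := mul_le_of_le_one_right hpos.le hs1
          _ ≤ _ := by
            simp only [hρj]
            gcongr
            linarith
      have hsub : ball (a + ρj j • y) (ρj j * s) ⊆ ball c (2 ^ k * r) := by
        refine ball_subset_ball' ?_
        have h1 : dist (a + ρj j • y) c ≤ ρj j + ‖c - a‖ := by
          rw [dist_eq_norm, show a + ρj j • y - c = ρj j • y - (c - a) by abel]
          refine (norm_sub_le _ _).trans ?_
          rw [hnorm]
          gcongr
          exact mul_le_of_le_one_right hpos.le hy2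
        have h2 : ρj j * s ≤ ρj j := mul_le_of_le_one_right hpos.le hs1
        have h3 := hρjle j
        linarith
      have h1 := hrev _ _ _ _ j (by positivity) (by positivity) hle hsub
      have h2 := hdoub c r k hr
      have hφc := (hφ c r hr).le
      rw [mul_assoc K, mul_assoc K, ← ENNReal.ofReal_mul (by positivity),
        ← ENNReal.ofReal_pow hθ0.le, ← ENNReal.ofReal_mul (by positivity)]
      gcongr
      calc _ ≤ C₁ * θ ^ j * φ c (2 ^ k * r) := h1
        _ ≤ C₁ * θ ^ j * (C₂ ^ k * φ c r) := by gcongr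
        _ = _ := by ring
  -- The dyadic annuli about `a` miss only `a` itself, which is `T`-null by absolute continuity.
  have hsub : ball c r ⊆ {a} ∪ ⋃ j, ⋃ y ∈ S, ball (a + ρj j • y) (ρj j * s) := by
    intro x hx
    rcases eq_or_ne x a with rfl | hxa
    · exact Or.inl rfl
    right
    have hd0 : 0 < ‖x - a‖ := norm_pos_iff.2 (sub_ne_zero.2 hxa)
    have hd1 : ‖x - a‖ ≤ ρ := by
      rw [mem_ball, dist_eq_norm] at hx
      calc ‖x - a‖ = ‖(x - c) + (c - a)‖ := by congr 1; abel
        _ ≤ _ := norm_add_le _ _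
        _ ≤ _ := by linarith
    obtain ⟨j, hj1, hj2⟩ := exists_nat_pow_near_of_lt_one (x := ‖x - a‖ / ρ) (y := 1 / 2)
      (by positivity) ((div_le_one hρ0).2 hd1) (by norm_num) (by norm_num)
    rw [lt_div_iff₀ hρ0, pow_succ] at hj1
    rw [div_le_iff₀ hρ0] at hj2
    obtain ⟨y, hy, hxy⟩ := hcov (ρj j) (hρj0 j) x (by simp only [hρj]; linarith) hj2
    exact Set.mem_iUnion.2 ⟨j, Set.mem_biUnion hy hxy⟩
  have : Nonempty (Fin n) := ⟨⟨0, hn⟩⟩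
  have hTa : T {a} = 0 := hT (measure_singleton a)
  calc T (ball c r) ≤ T {a} + T (⋃ j, ⋃ y ∈ S, ball (a + ρj j • y) (ρj j * s)) :=
        (measure_mono hsub).trans (measure_union_le _ _)
    _ ≤ ∑' j, ∑ y ∈ S, T (ball (a + ρj j • y) (ρj j * s)) := by
        rw [hTa, zero_add]
        refine (measure_iUnion_le _).trans (ENNReal.tsum_le_tsum fun j => ?_)
        exact measure_biUnion_finset_le _ _
    _ ≤ ∑' j : ℕ, S.card * (K * ENNReal.ofReal (C₁ * C₂ ^ k) * ENNReal.ofReal (φ c r) *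
          ENNReal.ofReal θ ^ j) := by
        refine ENNReal.tsum_le_tsum fun j => ?_
        rw [← nsmul_eq_mul]
        exact Finset.sum_le_card_nsmul _ _ _ (hpiece j)
    _ = S.card * ENNReal.ofReal (C₁ * C₂ ^ k) * (1 - ENNReal.ofReal θ)⁻¹ * K *
          ENNReal.ofReal (φ c r) := by
        rw [ENNReal.tsum_mul_left, ENNReal.tsum_mul_left, ENNReal.tsum_geometric]
        ring
    _ ≤ _ := by
        gcongr
        exact le_add_self

/-! ### Morrey norms, duality and triviality of weights -/

variable {n : ℕ}

lemma IsWeight.aemeasurable_ofReal {w : Rn n → ℝ} (hw : IsWeight w) :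
    AEMeasurable (fun x => ENNReal.ofReal (w x)) :=
  hw.2.aestronglyMeasurable.aemeasurable.ennreal_ofReal

lemma IsWeight.wMass_ball_ne_top {w : Rn n → ℝ} (hw : IsWeight w) (c : Rn n) (r : ℝ) :
    wMass w (ball c r) ≠ ∞ := by
  have h : IntegrableOn w (closedBall c r) :=
    hw.2.integrableOn_isCompact (isCompact_closedBall c r)
  have h2 := (h.mono_set ball_subset_closedBall).2
  refine ne_top_of_le_ne_top h2.ne (lintegral_mono fun x => ?_)
  exact Real.ofReal_le_enorm _

lemma hlMaximal_eq_averageMaximal (f : Rn n → ℝ) :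
    hlMaximal f = averageMaximal volume {b | 0 < b.2} (fun x => ‖f x‖ₑ) := by
  funext x
  simp only [hlMaximal, averageMaximal, iSup_prod]
  rfl

lemma measurable_hlMaximal (f : Rn n → ℝ) : Measurable (hlMaximal f) := by
  rw [hlMaximal_eq_averageMaximal]
  exact measurable_averageMaximal _ _ _

lemma setLIntegral_le_morreyNorm {φ : Rn n → ℝ → ℝ} (hφ : IsPositiveOnBalls φ) (w : Rn n → ℝ)
    {p : ℝ} (hp : 0 < p) (F : Rn n → ℝ≥0∞) (c : Rn n) {r : ℝ} (hr : 0 < r) :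
    ∫⁻ x in ball c r, F x ^ p * ENNReal.ofReal (w x) ≤
      morreyNorm φ w p F ^ p * ENNReal.ofReal (φ c r) := by
  have h : ((∫⁻ x in ball c r, F x ^ p * ENNReal.ofReal (w x)) / ENNReal.ofReal (φ c r)) ^ (1 / p)
      ≤ morreyNorm φ w p F := le_iSup₂_of_le c r (le_iSup_of_le hr le_rfl)
  rw [one_div, ENNReal.rpow_inv_le_iff hp] at h
  rwa [ENNReal.div_le_iff (by simpa using hφ c r hr) ENNReal.ofReal_ne_top] at h

lemma morreyNorm_le {φ : Rn n → ℝ → ℝ} (hφ : IsPositiveOnBalls φ) {w : Rn n → ℝ}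
    {p : ℝ} (hp : 0 < p) {F : Rn n → ℝ≥0∞} {K : ℝ≥0∞}
    (h : ∀ c r, 0 < r → ∫⁻ x in ball c r, F x ^ p * ENNReal.ofReal (w x) ≤
      K ^ p * ENNReal.ofReal (φ c r)) : morreyNorm φ w p F ≤ K := by
  refine iSup₂_le fun c r => iSup_le fun hr => ?_
  rw [one_div, ENNReal.rpow_inv_le_iff hp,
    ENNReal.div_le_iff (by simpa using hφ c r hr) ENNReal.ofReal_ne_top]
  exact h c r hr

lemma morreyNorm_const_mul_le {φ : Rn n → ℝ → ℝ} (hφ : IsPositiveOnBalls φ) (w : Rn n → ℝ)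
    {p : ℝ} (hp : 0 < p) (k : ℝ) (f : Rn n → ℝ) :
    morreyNorm φ w p (fun x => ‖k * f x‖ₑ) ≤ ‖k‖ₑ * morreyNorm φ w p (fun x => ‖f x‖ₑ) := by
  refine morreyNorm_le hφ hp fun c r hr => ?_
  calc ∫⁻ x in ball c r, ‖k * f x‖ₑ ^ p * ENNReal.ofReal (w x)
      = ∫⁻ x in ball c r, ‖k‖ₑ ^ p * (‖f x‖ₑ ^ p * ENNReal.ofReal (w x)) := by
        refine lintegral_congr fun x => ?_
        rw [enorm_mul, ENNReal.mul_rpow_of_nonneg _ _ hp.le, mul_assoc]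
    _ = ‖k‖ₑ ^ p * ∫⁻ x in ball c r, ‖f x‖ₑ ^ p * ENNReal.ofReal (w x) :=
        lintegral_const_mul' _ _ (ENNReal.rpow_ne_top_of_nonneg hp.le enorm_ne_top)
    _ ≤ ‖k‖ₑ ^ p * (morreyNorm φ w p (fun x => ‖f x‖ₑ) ^ p * ENNReal.ofReal (φ c r)) := by
        gcongr
        exact setLIntegral_le_morreyNorm hφ w hp _ c hr
    _ = _ := by rw [ENNReal.mul_rpow_of_nonneg _ _ hp.le, mul_assoc]

/-- Normalize `f` by `k` and test the dual norm. A nonzero upper bound `k` replaces the norm itself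
so that functions of norm zero are covered. -/
lemma setLIntegral_enorm_le_mul_kotheDualNorm {φ : Rn n → ℝ → ℝ} (hφ : IsPositiveOnBalls φ)
    {w : Rn n → ℝ} {p : ℝ} (hp : 0 < p) {f : Rn n → ℝ} (hf : MemMorrey φ w p f) {k : ℝ≥0}
    (hk : k ≠ 0) (hfk : morreyNorm φ w p (fun x => ‖f x‖ₑ) ≤ k) (c : Rn n) (r : ℝ) :
    ∫⁻ x in ball c r, ‖f x‖ₑ ≤ k * kotheDualNorm φ w p (ballChar c r) := by
  have hk' : (k : ℝ≥0∞) ≠ 0 := by simpa using hk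
  have hkk : ‖((k⁻¹ : ℝ≥0) : ℝ)‖ₑ = (k : ℝ≥0∞)⁻¹ := by
    rw [Real.enorm_eq_ofReal (NNReal.coe_nonneg _), ENNReal.ofReal_coe_nnreal, ENNReal.coe_inv hk]
  have hnorm : morreyNorm φ w p (fun x => ‖((k⁻¹ : ℝ≥0) : ℝ) * f x‖ₑ) ≤ 1 := by
    refine (morreyNorm_const_mul_le hφ w hp _ f).trans ?_
    rw [hkk]
    calc (k : ℝ≥0∞)⁻¹ * morreyNorm φ w p (fun x => ‖f x‖ₑ) ≤ (k : ℝ≥0∞)⁻¹ * k := by gcongr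
      _ ≤ 1 := ENNReal.inv_mul_le_one _
  have hmem : MemMorrey φ w p (fun x => ((k⁻¹ : ℝ≥0) : ℝ) * f x) :=
    ⟨hf.1.const_mul _, hnorm.trans_lt ENNReal.one_lt_top⟩
  have hle : ∫⁻ x, ‖((k⁻¹ : ℝ≥0) : ℝ) * f x * ballChar c r x‖ₑ ≤
      kotheDualNorm φ w p (ballChar c r) :=
    le_iSup₂_of_le _ hmem (le_iSup_of_le hnorm le_rfl)
  have hint : ∫⁻ x, ‖((k⁻¹ : ℝ≥0) : ℝ) * f x * ballChar c r x‖ₑ =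
      (k : ℝ≥0∞)⁻¹ * ∫⁻ x in ball c r, ‖f x‖ₑ := by
    rw [← lintegral_const_mul' _ _ (ENNReal.inv_ne_top.2 hk'), ← lintegral_indicator
      measurableSet_ball]
    refine lintegral_congr fun x => ?_
    by_cases hx : x ∈ ball c r
    · rw [ballChar, Set.indicator_of_mem hx, Set.indicator_of_mem hx, mul_one, enorm_mul, hkk]
    · simp [ballChar, hx]
  rw [hint] at hle
  calc ∫⁻ x in ball c r, ‖f x‖ₑ = k * ((k : ℝ≥0∞)⁻¹ * ∫⁻ x in ball c r, ‖f x‖ₑ) := by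
        rw [← mul_assoc, ENNReal.mul_inv_cancel hk' ENNReal.coe_ne_top, one_mul]
    _ ≤ _ := by gcongr

lemma wMass_div_rpow_le_morreyNorm_ballChar (φ : Rn n → ℝ → ℝ) (w : Rn n → ℝ) {p : ℝ}
    {c₁ c₂ : Rn n} {r₁ r₂ : ℝ} (hr₁ : 0 < r₁) (hsub : ball c₁ r₁ ⊆ ball c₂ r₂) :
    (wMass w (ball c₁ r₁) / ENNReal.ofReal (φ c₁ r₁)) ^ (1 / p) ≤
      morreyNorm φ w p (fun x => ‖ballChar c₂ r₂ x‖ₑ) := by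
  refine le_iSup₂_of_le c₁ r₁ (le_iSup_of_le hr₁ (le_of_eq ?_))
  congr 2
  refine setLIntegral_congr_fun measurableSet_ball fun x hx => ?_
  simp [ballChar, hsub hx]

/-- The `A(𝓜^p(φ))` condition bounds the integral of a function over a ball by its Morrey norm. -/
lemma mul_setLIntegral_enorm_le_muckenhouptMorreyConst {φ : Rn n → ℝ → ℝ}
    (hφ : IsPositiveOnBalls φ) {w : Rn n → ℝ} {p : ℝ} (hp : 0 < p)
    (hA : MuckenhouptMorrey φ p w) {f : Rn n → ℝ} (hf : MemMorrey φ w p f)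
    {c₁ c₂ : Rn n} {r₁ r₂ : ℝ} (hr₁ : 0 < r₁) (hr₂ : 0 < r₂) (hsub : ball c₁ r₁ ⊆ ball c₂ r₂) :
    (wMass w (ball c₁ r₁) / ENNReal.ofReal (φ c₁ r₁)) ^ (1 / p) * ∫⁻ x in ball c₂ r₂, ‖f x‖ₑ ≤
      muckenhouptMorreyConst φ w p * volume (ball c₂ r₂) *
        morreyNorm φ w p (fun x => ‖f x‖ₑ) := by
  have hv0 : volume (ball c₂ r₂) ≠ 0 := (measure_ball_pos _ _ hr₂).ne'
  have hvt : volume (ball c₂ r₂) ≠ ∞ := measure_ball_lt_top.ne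
  have hAB : morreyNorm φ w p (fun x => ‖ballChar c₂ r₂ x‖ₑ) *
      kotheDualNorm φ w p (ballChar c₂ r₂) ≤
        muckenhouptMorreyConst φ w p * volume (ball c₂ r₂) := by
    rw [← ENNReal.div_le_iff hv0 hvt]
    exact le_iSup₂_of_le c₂ r₂ (le_iSup_of_le hr₂ le_rfl)
  have key : ∀ k : ℝ≥0, k ≠ 0 → morreyNorm φ w p (fun x => ‖f x‖ₑ) ≤ k →
      (wMass w (ball c₁ r₁) / ENNReal.ofReal (φ c₁ r₁)) ^ (1 / p) * ∫⁻ x in ball c₂ r₂, ‖f x‖ₑ ≤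
        muckenhouptMorreyConst φ w p * volume (ball c₂ r₂) * k := by
    intro k hk hfk
    calc _ ≤ morreyNorm φ w p (fun x => ‖ballChar c₂ r₂ x‖ₑ) *
          (k * kotheDualNorm φ w p (ballChar c₂ r₂)) := by
          gcongr
          · exact wMass_div_rpow_le_morreyNorm_ballChar φ w hr₁ hsub
          · exact setLIntegral_enorm_le_mul_kotheDualNorm hφ hp hf hk hfk c₂ r₂
      _ = morreyNorm φ w p (fun x => ‖ballChar c₂ r₂ x‖ₑ) *
          kotheDualNorm φ w p (ballChar c₂ r₂) * k := by ring
      _ ≤ _ := by gcongr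
  set N := morreyNorm φ w p (fun x => ‖f x‖ₑ) with hN
  have hNtop : N ≠ ∞ := hf.2.ne
  -- For norm zero, `key` holds with arbitrarily small `k`, and the product on the left is zero.
  rcases eq_or_ne N 0 with h0 | h0
  · have hc : muckenhouptMorreyConst φ w p * volume (ball c₂ r₂) ≠ ∞ :=
      ENNReal.mul_ne_top hA.ne hvt
    refine ENNReal.le_of_forall_pos_le_add fun ε hε _ => ?_
    set c := muckenhouptMorreyConst φ w p * volume (ball c₂ r₂) with hcdef
    lift c to ℝ≥0 using hc with c'
    refine (key (ε / (c' + 1)) (by positivity) (by rw [h0]; exact zero_le)).trans ?_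
    rw [h0, mul_zero, zero_add, ← ENNReal.coe_mul, ENNReal.coe_le_coe, mul_div_assoc']
    rw [div_le_iff₀ (by positivity), mul_comm]
    gcongr
    exact le_self_add
  · lift N to ℝ≥0 using hNtop with N'
    exact key N' (by simpa using h0) le_rfl

lemma ae_of_forall_ae_restrict_ball {P : Rn n → Prop}
    (h : ∀ k : ℕ, ∀ᵐ x ∂(volume.restrict (ball (0 : Rn n) k)), P x) : ∀ᵐ x, P x := by
  have := (ae_restrict_iUnion_iff (μ := volume) (fun k : ℕ => ball (0 : Rn n) k) P).2 h
  rwa [iUnion_ball_nat, Measure.restrict_univ] at this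

/-- A weight in `A(𝓜^p(φ))` is either trivial or positive almost everywhere. -/
lemma ae_eq_zero_or_ae_ne_zero_of_muckenhouptMorrey {φ : Rn n → ℝ → ℝ}
    (hφ : IsPositiveOnBalls φ) {w : Rn n → ℝ} (hw : IsWeight w) {p : ℝ} (hp : 0 < p)
    (hA : MuckenhouptMorrey φ p w) :
    (∀ᵐ x, ENNReal.ofReal (w x) = 0) ∨ ∀ᵐ x, ENNReal.ofReal (w x) ≠ 0 := by
  set Z : Set (Rn n) := {x | ENNReal.ofReal (w x) = 0} with hZ
  have hZm : NullMeasurableSet Z := hw.aemeasurable_ofReal.nullMeasurable (measurableSet_singleton 0)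
  -- The indicator of the zero set of `w` has Morrey norm zero. On each centered ball the condition
  -- then forces either zero mass of `w` or a null zero set; nestedness of the balls makes the
  -- alternative global.
  set f : Rn n → ℝ := Z.indicator fun _ => 1 with hf
  have hfm : AEMeasurable f := aemeasurable_const.indicator₀ hZm
  have hnorm : morreyNorm φ w p (fun x => ‖f x‖ₑ) = 0 := by
    refine le_antisymm (morreyNorm_le hφ hp fun c r hr => ?_) zero_le
    rw [ENNReal.zero_rpow_of_pos hp, zero_mul, nonpos_iff_eq_zero]
    refine (lintegral_congr fun x => ?_).trans lintegral_zero
    by_cases hx : x ∈ Z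
    · rw [show ENNReal.ofReal (w x) = 0 from hx, mul_zero]
    · rw [hf, Set.indicator_of_notMem hx, enorm_zero, ENNReal.zero_rpow_of_pos hp, zero_mul]
  have hmem : MemMorrey φ w p f := ⟨hfm, by rw [hnorm]; exact ENNReal.zero_lt_top⟩
  have hor : ∀ k : ℕ, (∀ᵐ x ∂(volume.restrict (ball (0 : Rn n) k)), ENNReal.ofReal (w x) = 0) ∨
      ∀ᵐ x ∂(volume.restrict (ball (0 : Rn n) k)), ENNReal.ofReal (w x) ≠ 0 := by
    intro k
    rcases Nat.eq_zero_or_pos k with rfl | hk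
    · simp
    have hk' : (0 : ℝ) < k := by exact_mod_cast hk
    have h := mul_setLIntegral_enorm_le_muckenhouptMorreyConst hφ hp hA hmem
      (c₁ := 0) hk' hk' subset_rfl
    rw [hnorm, mul_zero, nonpos_iff_eq_zero, mul_eq_zero,
      ENNReal.rpow_eq_zero_iff_of_pos (by positivity), ENNReal.div_eq_zero_iff] at h
    rcases h with (h | h) | h
    · exact Or.inl ((lintegral_eq_zero_iff' hw.aemeasurable_ofReal.restrict).1 h)
    · exact absurd h ENNReal.ofReal_ne_top
    · right
      filter_upwards [(lintegral_eq_zero_iff' hfm.enorm.restrict).1 h] with x hx hx0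
      rw [hf, Pi.zero_apply, Set.indicator_of_mem (by exact hx0)] at hx
      simp at hx
  by_cases hall : ∀ k : ℕ, ∀ᵐ x ∂(volume.restrict (ball (0 : Rn n) k)), ENNReal.ofReal (w x) ≠ 0
  · exact Or.inr (ae_of_forall_ae_restrict_ball hall)
  · left
    push Not at hall
    obtain ⟨k₀, hk₀⟩ := hall
    refine ae_of_forall_ae_restrict_ball fun k => ?_
    have hmono : ∀ {i : ℕ}, i ≤ max k k₀ → ball (0 : Rn n) i ⊆ ball 0 (max k k₀ : ℕ) := fun hi =>
      ball_subset_ball (by exact_mod_cast hi)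
    rcases hor (max k k₀) with h | h
    · exact ae_restrict_of_ae_restrict_of_subset (hmono (le_max_left _ _)) h
    · exact absurd (ae_restrict_of_ae_restrict_of_subset (hmono (le_max_right _ _)) h) hk₀

lemma IsWeight.wMass_ball_ne_zero {w : Rn n → ℝ} (hw : IsWeight w)
    (h0 : ∀ᵐ x, ENNReal.ofReal (w x) ≠ 0) (c : Rn n) {r : ℝ} (hr : 0 < r) :
    wMass w (ball c r) ≠ 0 := by
  have h := withDensity_absolutelyContinuous' hw.aemeasurable_ofReal h0
  intro hz
  refine (measure_ball_pos volume c hr).ne' (h ?_)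
  rwa [withDensity_apply _ measurableSet_ball]

/-! ### Splitting the maximal function on a local ball -/

/-- The balls which meet `B(c, r)` and have a smaller radius. -/
def smallBalls (c : Rn n) (r : ℝ) : Set (Rn n × ℝ) :=
  {b | 0 < b.2 ∧ b.2 < r ∧ dist b.1 c < b.2 + r}

lemma volume_ball_mul (c : Rn n) {k : ℝ} (hk : 0 < k) (r : ℝ) :
    volume (ball c (k * r)) = ENNReal.ofReal (k ^ n) * volume (ball c r) := by
  rw [Measure.addHaar_ball_mul_of_pos _ _ hk, finrank_euclideanSpace_fin,
    Measure.addHaar_ball_center volume c]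

/-- On a ball `B`, the maximal function is controlled by the averages over balls smaller than `B`
and by the value which the `A(𝓜^p(φ))` condition yields for the averages over larger balls. -/
lemma hlMaximal_le_max {φ : Rn n → ℝ → ℝ} (hφ : IsPositiveOnBalls φ) {w : Rn n → ℝ}
    (hw : IsWeight w) (h0 : ∀ᵐ x, ENNReal.ofReal (w x) ≠ 0) {p : ℝ} (hp : 0 < p)
    (hA : MuckenhouptMorrey φ p w) {f : Rn n → ℝ} (hf : MemMorrey φ w p f) {c : Rn n} {r : ℝ}
    (hr : 0 < r) {x : Rn n} (hx : x ∈ ball c r) :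
    hlMaximal f x ≤ max (averageMaximal volume (smallBalls c r)
        ((ball c (2 ^ 2 * r)).indicator fun y => ‖f y‖ₑ) x)
      (ENNReal.ofReal (3 ^ n) * muckenhouptMorreyConst φ w p *
        morreyNorm φ w p (fun y => ‖f y‖ₑ) /
          (wMass w (ball c r) / ENNReal.ofReal (φ c r)) ^ (1 / p)) := by
  rw [hlMaximal_eq_averageMaximal]
  refine averageMaximal_le fun b (hb : 0 < b.2) hxb => ?_
  have hdist : dist b.1 c < b.2 + r :=
    (dist_triangle_left b.1 c x).trans_lt (add_lt_add hxb hx)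
  rcases lt_or_ge b.2 r with hbr | hbr
  · refine le_max_of_le_left (le_trans (le_of_eq ?_)
      (le_averageMaximal _ (show b ∈ smallBalls c r from ⟨hb, hbr, hdist⟩) hxb))
    congr 1
    refine setLIntegral_congr_fun measurableSet_ball fun y hy => ?_
    rw [Set.indicator_of_mem]
    exact ball_subset_ball' (by linarith) hy
  · refine le_max_of_le_right ?_
    -- The triple contains `B(c, r)`, so its characteristic function has norm at least
    -- `(w(B)/φ(B))^(1/p)`. Passing to the triple costs the factor `3^n`.
    have hsub : ball c r ⊆ ball b.1 (3 * b.2) :=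
      ball_subset_ball' (by rw [dist_comm]; linarith)
    have hv0 : volume (ball b.1 b.2) ≠ 0 := (measure_ball_pos _ _ hb).ne'
    have hvt : volume (ball b.1 b.2) ≠ ∞ := measure_ball_lt_top.ne
    have hφ0 : ENNReal.ofReal (φ c r) ≠ 0 := by simpa using hφ c r hr
    have hq0 : wMass w (ball c r) / ENNReal.ofReal (φ c r) ≠ 0 :=
      ENNReal.div_ne_zero.2 ⟨hw.wMass_ball_ne_zero h0 c hr, ENNReal.ofReal_ne_top⟩
    have hqt : wMass w (ball c r) / ENNReal.ofReal (φ c r) ≠ ∞ :=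
      ENNReal.div_ne_top (hw.wMass_ball_ne_top c r) hφ0
    rw [ENNReal.le_div_iff_mul_le
      (Or.inl (by rwa [ne_eq, ENNReal.rpow_eq_zero_iff_of_pos (by positivity)]))
      (Or.inl (ENNReal.rpow_ne_top_of_nonneg (by positivity) hqt)), mul_comm, ← mul_div_assoc]
    refine ENNReal.div_le_of_le_mul ?_
    calc _ ≤ (wMass w (ball c r) / ENNReal.ofReal (φ c r)) ^ (1 / p) *
          ∫⁻ y in ball b.1 (3 * b.2), ‖f y‖ₑ := by
          gcongr
          linarith
      _ ≤ muckenhouptMorreyConst φ w p * volume (ball b.1 (3 * b.2)) *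
          morreyNorm φ w p (fun y => ‖f y‖ₑ) :=
        mul_setLIntegral_enorm_le_muckenhouptMorreyConst hφ hp hA hf hr (by positivity) hsub
      _ = _ := by rw [volume_ball_mul _ three_pos]; ring

lemma preimage_add_right_ball (a c : Rn n) (r : ℝ) :
    (fun x => x + a) ⁻¹' ball c r = ball (c - a) r := by
  ext x
  rw [Set.mem_preimage, mem_ball, mem_ball, dist_eq_norm, dist_eq_norm, sub_sub_eq_add_sub]

lemma setLIntegral_ball_comp_add_right (g : Rn n → ℝ≥0∞) (a c : Rn n) (r : ℝ) :
    ∫⁻ x in ball (c - a) r, g (x + a) = ∫⁻ x in ball c r, g x := by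
  rw [← preimage_add_right_ball]
  exact (measurePreserving_add_right volume a).setLIntegral_comp_preimage_emb
    (MeasurableEquiv.addRight a).measurableEmbedding g _

lemma ae_restrict_ball_of_comp_add_right {P : Rn n → Prop} {a c : Rn n} {r : ℝ}
    (h : ∀ᵐ x ∂(volume.restrict (ball (c - a) r)), P (x + a)) :
    ∀ᵐ x ∂(volume.restrict (ball c r)), P x := by
  rw [← preimage_add_right_ball] at h
  have hemb : MeasurableEmbedding fun x : Rn n => x + a :=
    (MeasurableEquiv.addRight a).measurableEmbedding
  have hmp := (measurePreserving_add_right (volume : Measure (Rn n)) a).restrict_preimage_emb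
    hemb (ball c r)
  rw [← hmp.map_eq]
  exact hemb.ae_map_iff.2 h

lemma volume_ball_sub (a c : Rn n) (r : ℝ) : volume (ball (c - a) r) = volume (ball c r) := by
  rw [Measure.addHaar_ball_center, Measure.addHaar_ball_center volume c]

lemma rpow_mul_rpow_le_apLocConst {κ p : ℝ} {w : Rn n → ℝ} {a : Rn n} {c : Rn n} {r : ℝ} (hr : 0 < r)
    (hloc : r < κ * ‖c - a‖) :
    (∫⁻ x in ball c r, ENNReal.ofReal (w x)) ^ (1 / p) *
      (∫⁻ x in ball c r, ENNReal.ofReal (w x) ^ (1 - p.conjExponent)) ^ (1 / p.conjExponent) ≤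
      apLocConst κ p (fun x => w (x + a)) * volume (ball c r) := by
  have h : wMass (fun x => w (x + a)) (ball (c - a) r) ^ (1 / p) *
      (∫⁻ x in ball (c - a) r, ENNReal.ofReal (w (x + a)) ^ (1 - p.conjExponent)) ^
        (1 / p.conjExponent) / volume (ball (c - a) r) ≤ apLocConst κ p (fun x => w (x + a)) :=
    le_iSup₂_of_le (c - a) r (le_iSup₂_of_le hr hloc le_rfl)
  rw [wMass, setLIntegral_ball_comp_add_right (fun x => ENNReal.ofReal (w x)),
    setLIntegral_ball_comp_add_right (fun x => ENNReal.ofReal (w x) ^ (1 - p.conjExponent)),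
    volume_ball_sub, ENNReal.div_le_iff (measure_ball_pos _ _ hr).ne' measure_ball_lt_top.ne] at h
  exact h

lemma ae_le_a1LocConst {κ : ℝ} {w : Rn n → ℝ} {a : Rn n} (h0 : ∀ᵐ x, ENNReal.ofReal (w x) ≠ 0)
    {c : Rn n} {r : ℝ} (hr : 0 < r) (hloc : r < κ * ‖c - a‖) :
    ∀ᵐ x ∂(volume.restrict (ball c r)), ∫⁻ y in ball c r, ENNReal.ofReal (w y) ≤
      a1LocConst κ (fun x => w (x + a)) * volume (ball c r) * ENNReal.ofReal (w x) := by
  have h : wMass (fun x => w (x + a)) (ball (c - a) r) *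
      essSup (fun x => (ENNReal.ofReal (w (x + a)))⁻¹) (volume.restrict (ball (c - a) r)) /
        volume (ball (c - a) r) ≤ a1LocConst κ (fun x => w (x + a)) :=
    le_iSup₂_of_le (c - a) r (le_iSup₂_of_le hr hloc le_rfl)
  rw [wMass, setLIntegral_ball_comp_add_right (fun x => ENNReal.ofReal (w x)),
    volume_ball_sub, ENNReal.div_le_iff (measure_ball_pos _ _ hr).ne' measure_ball_lt_top.ne] at h
  have hle : ∀ᵐ x ∂(volume.restrict (ball c r)), (∫⁻ y in ball c r, ENNReal.ofReal (w y)) *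
      (ENNReal.ofReal (w x))⁻¹ ≤ a1LocConst κ (fun x => w (x + a)) * volume (ball c r) := by
    refine ae_restrict_ball_of_comp_add_right (a := a) ?_
    filter_upwards [ENNReal.ae_le_essSup (μ := volume.restrict (ball (c - a) r))
      (fun x => (ENNReal.ofReal (w (x + a)))⁻¹)] with x hx
    exact le_trans (by gcongr) h
  filter_upwards [hle, ae_restrict_of_ae h0] with x hx hx0
  rwa [← div_eq_mul_inv, ENNReal.div_le_iff hx0 ENNReal.ofReal_ne_top] at hx

/-- Since `8r < κ‖c - a‖` and the center of `b` is within `2r` of `c`, one has `κ‖b.1 - a‖ > 8r -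
2κr > 6r`, which exceeds the enlarged radius. -/
lemma smallBalls_local {κ : ℝ} (hκ0 : 0 < κ) (hκ1 : κ < 1) {a c : Rn n} {r : ℝ}
    (hloc : r < κ / 8 * ‖c - a‖) {b : Rn n × ℝ} (hb : b ∈ smallBalls c r)
    {k : ℝ} (hk : k ∈ ({1, 6} : Set ℝ)) : 0 < k * b.2 ∧ k * b.2 < κ * ‖b.1 - a‖ := by
  obtain ⟨hb0, hbr, hbd⟩ := hb
  have hk' : 0 < k ∧ k ≤ 6 := by
    rcases hk with rfl | hk
    · norm_num
    · rw [Set.mem_singleton_iff.1 hk]; norm_num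
  refine ⟨mul_pos hk'.1 hb0, ?_⟩
  have h1 : ‖c - a‖ ≤ ‖b.1 - a‖ + dist b.1 c := by
    rw [← dist_eq_norm, ← dist_eq_norm, dist_comm b.1 c]
    linarith [dist_triangle c b.1 a]
  have h2 : ‖c - a‖ ≤ ‖b.1 - a‖ + 2 * r := by linarith
  have h3 : κ * ‖c - a‖ ≤ κ * ‖b.1 - a‖ + 2 * r * κ := by
    have := mul_le_mul_of_nonneg_left h2 hκ0.le
    linarith
  have h4 : 2 * r * κ ≤ 2 * r := mul_le_of_le_one_right (by linarith) hκ1.le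
  have h5 : k * b.2 ≤ 6 * b.2 := by gcongr; exact hk'.2
  linarith

/-! ### The necessary condition and the two boundedness theorems -/

lemma weakMorreyNorm_le {φ : Rn n → ℝ → ℝ} (hφ : IsPositiveOnBalls φ) {w : Rn n → ℝ}
    {F : Rn n → ℝ≥0∞} {K : ℝ≥0∞}
    (h : ∀ c r, 0 < r → ∀ t : ℝ≥0, (t : ℝ≥0∞) * wMass w {x ∈ ball c r | (t : ℝ≥0∞) < F x} ≤
      K * ENNReal.ofReal (φ c r)) : weakMorreyNorm φ w 1 F ≤ K := by
  refine iSup₂_le fun c r => iSup_le fun hr => iSup₂_le fun t _ => ?_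
  rw [one_div_one, ENNReal.rpow_one, ENNReal.rpow_one,
    ENNReal.div_le_iff (by simpa using hφ c r hr) ENNReal.ofReal_ne_top]
  exact h c r hr t

/-- Weak boundedness of the maximal operator implies the `A(𝓜^p(φ))` condition. -/
theorem MaximalWeakBounded.muckenhouptMorrey {φ : Rn n → ℝ → ℝ} {w : Rn n → ℝ} {p : ℝ}
    (hp : 0 < p) (h : MaximalWeakBounded φ w p) : MuckenhouptMorrey φ p w := by
  obtain ⟨C, hC⟩ := h
  refine lt_of_le_of_lt (b := (C : ℝ≥0∞)) ?_ ENNReal.coe_lt_top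
  refine iSup₂_le fun c r => iSup_le fun hr => ?_
  refine ENNReal.div_le_of_le_mul ?_
  simp only [kotheDualNorm, ENNReal.mul_iSup, iSup_le_iff]
  intro f hf hf1
  have hv0 : volume (ball c r) ≠ 0 := (measure_ball_pos _ _ hr).ne'
  have hvt : volume (ball c r) ≠ ∞ := measure_ball_lt_top.ne
  have hint : ∫⁻ x, ‖f x * ballChar c r x‖ₑ = ∫⁻ x in ball c r, ‖f x‖ₑ := by
    rw [← lintegral_indicator measurableSet_ball]
    refine lintegral_congr fun x => ?_
    by_cases hx : x ∈ ball c r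
    · simp [ballChar, hx]
    · simp [ballChar, hx]
  rw [hint, ← ENNReal.div_le_iff hv0 hvt, mul_div_assoc]
  set s := (∫⁻ x in ball c r, ‖f x‖ₑ) / volume (ball c r) with hs
  have hMs : ∀ x ∈ ball c r, s ≤ hlMaximal f x := fun x hx =>
    le_iSup₂_of_le c r (le_iSup₂_of_le hr hx le_rfl)
  have hweak : weakMorreyNorm φ w p (hlMaximal f) ≤ C := by
    refine (hC f hf).trans ?_
    calc (C : ℝ≥0∞) * _ ≤ C * 1 := by gcongr
      _ = C := mul_one _
  have hp' : 0 < 1 / p := by positivity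
  -- Level sets are strict, so the argument works at `t < s` and passes to the limit; this also
  -- covers `s = ∞`.
  have key : ∀ t : ℝ≥0, 0 < t → (t : ℝ≥0∞) < s →
      morreyNorm φ w p (fun x => ‖ballChar c r x‖ₑ) * t ≤ C := by
    intro t ht hts
    refine le_trans ?_ hweak
    rw [morreyNorm, ENNReal.iSup_mul]
    refine iSup_le fun c' => ?_
    rw [ENNReal.iSup_mul]
    refine iSup_le fun r' => ?_
    rw [ENNReal.iSup_mul]
    refine iSup_le fun hr' => ?_
    refine le_trans ?_ (le_iSup₂_of_le c' r' (le_iSup_of_le hr' (le_iSup₂_of_le t ht le_rfl)))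
    rw [ENNReal.div_rpow_of_nonneg _ _ hp'.le, mul_comm, ← mul_div_assoc]
    gcongr
    calc ∫⁻ x in ball c' r', ‖ballChar c r x‖ₑ ^ p * ENNReal.ofReal (w x)
        = ∫⁻ x in ball c' r', (ball c r).indicator (fun x => ENNReal.ofReal (w x)) x := by
          refine lintegral_congr fun x => ?_
          by_cases hx : x ∈ ball c r
          · simp [ballChar, hx]
          · simp [ballChar, hx, hp]
      _ = ∫⁻ x in ball c r ∩ ball c' r', ENNReal.ofReal (w x) := by
          rw [lintegral_indicator measurableSet_ball, Measure.restrict_restrict measurableSet_ball]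
      _ ≤ _ := lintegral_mono_set fun x hx =>
          (⟨hx.2, hts.trans_le (hMs x hx.1)⟩ : x ∈ ball c' r' ∧ (t : ℝ≥0∞) < hlMaximal f x)
  refine ENNReal.mul_le_of_forall_lt fun b hb t hts => ?_
  lift t to ℝ≥0 using hts.ne_top
  rcases eq_or_ne t 0 with rfl | h0
  · simp
  · exact le_trans (by gcongr) (key t (pos_iff_ne_zero.2 h0) hts)

/-- The strong type inequality for the maximal operator on weighted Morrey spaces. -/
theorem MuckenhouptMorrey.maximalBounded (hn : 0 < n) {φ : Rn n → ℝ → ℝ}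
    (hφ : IsPositiveOnBalls φ) (hd : IsDoubling φ) (hr : IsReverseDoubling φ) {w : Rn n → ℝ}
    (hw : IsWeight w) {p : ℝ} (hp : 1 < p) {κ : ℝ} (hκ0 : 0 < κ) (hκ1 : κ < 1)
    (hA : MuckenhouptMorrey φ p w) {a : Rn n} (ha : ApLoc κ p (fun x => w (x + a))) :
    MaximalBounded φ w p := by
  have hp0 : 0 < p := by linarith
  rcases ae_eq_zero_or_ae_ne_zero_of_muckenhouptMorrey hφ hw hp0 hA with h0 | h0
  · refine ⟨0, fun f _ => ?_⟩
    refine (morreyNorm_le (K := 0) hφ hp0 fun c r hr => ?_).trans zero_le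
    rw [ENNReal.zero_rpow_of_pos hp0, zero_mul, nonpos_iff_eq_zero]
    refine (lintegral_congr_ae (ae_restrict_of_ae ?_)).trans lintegral_zero
    filter_upwards [h0] with x hx
    rw [hx, mul_zero]
  have hWm := hw.aemeasurable_ofReal
  obtain ⟨C₁, hC₁, hlocal⟩ := exists_lintegral_averageMaximal_rpow_mul_le
    (Real.HolderConjugate.conjExponent hp) hWm h0 (.of_forall fun _ => ENNReal.ofReal_ne_top)
    ha.ne (ENNReal.ofReal_ne_top (r := 6 ^ n))
  obtain ⟨C₂, hC₂, hdoub⟩ := hd.exists_le_pow hφ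
  obtain ⟨C₃, hC₃, hglob⟩ := exists_measure_ball_le_of_local hn hφ hd hr a
    (show 0 < κ / 8 by positivity)
  set A := muckenhouptMorreyConst φ w p with hAdef
  set K₀ : ℝ≥0∞ := C₁ * ENNReal.ofReal (C₂ ^ 2) + (ENNReal.ofReal (3 ^ n) * A) ^ p with hK₀
  have hAtop : A ≠ ∞ := hA.ne
  have hK₀top : C₃ * K₀ ≠ ∞ := by
    have := ENNReal.rpow_ne_top_of_nonneg hp0.le (ENNReal.mul_ne_top
      (ENNReal.ofReal_ne_top (r := 3 ^ n)) hAtop)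
    finiteness
  have hCtop : (C₃ * K₀) ^ (1 / p) ≠ ∞ := ENNReal.rpow_ne_top_of_nonneg (by positivity) hK₀top
  refine ⟨((C₃ * K₀) ^ (1 / p)).toNNReal, fun f hf => ?_⟩
  rw [ENNReal.coe_toNNReal hCtop]
  set N := morreyNorm φ w p (fun x => ‖f x‖ₑ) with hN
  -- With this measure the claim is a bound `T(B) ≲ ‖f‖^p φ(B)`, which need only be checked on local
  -- balls.
  set T : Measure (Rn n) := volume.withDensity
    (fun x => hlMaximal f x ^ p * ENNReal.ofReal (w x)) with hT
  have hTball : ∀ (c : Rn n) (r : ℝ), T (ball c r) =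
      ∫⁻ x in ball c r, hlMaximal f x ^ p * ENNReal.ofReal (w x) := fun c r =>
    withDensity_apply _ measurableSet_ball
  have hbound := hglob T (withDensity_absolutelyContinuous _ _) (K₀ * N ^ p) ?_
  · refine morreyNorm_le hφ hp0 fun c r hr => ?_
    rw [← hTball, ENNReal.mul_rpow_of_nonneg _ _ hp0.le, ← ENNReal.rpow_mul, one_div,
      inv_mul_cancel₀ hp0.ne', ENNReal.rpow_one, mul_assoc C₃]
    exact hbound c r hr
  intro c r hr hloc
  rw [hTball]
  set F := smallBalls c r with hF
  set g : Rn n → ℝ≥0∞ := (ball c (2 ^ 2 * r)).indicator fun y => ‖f y‖ₑ with hg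
  set m := wMass w (ball c r) with hm
  set Φ := ENNReal.ofReal (φ c r) with hΦ
  have hm0 : m ≠ 0 := hw.wMass_ball_ne_zero h0 c hr
  have hmt : m ≠ ∞ := hw.wMass_ball_ne_top c r
  have hΦ0 : Φ ≠ 0 := by simpa [hΦ] using hφ c r hr
  set L := ENNReal.ofReal (3 ^ n) * A * N / (m / Φ) ^ (1 / p) with hL
  -- The mass of the weight cancels: the constant from the large balls contributes exactly a
  -- multiple of `N^p Φ`.
  have hLm : L ^ p * m = (ENNReal.ofReal (3 ^ n) * A) ^ p * N ^ p * Φ := by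
    rw [hL, ENNReal.div_rpow_of_nonneg _ _ hp0.le, ← ENNReal.rpow_mul, one_div,
      inv_mul_cancel₀ hp0.ne', ENNReal.rpow_one, ENNReal.mul_rpow_of_nonneg _ _ hp0.le,
      div_eq_mul_inv, ENNReal.inv_div (Or.inl ENNReal.ofReal_ne_top) (Or.inl hΦ0), mul_assoc,
      ENNReal.div_mul_cancel hm0 hmt]
  have hgm : AEMeasurable g := hf.1.enorm.indicator measurableSet_ball
  have hsmall : ∫⁻ x, averageMaximal volume F g x ^ p * ENNReal.ofReal (w x) ≤
      C₁ * ∫⁻ x, g x ^ p * ENNReal.ofReal (w x) := by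
    refine hlocal F r (fun b hb => hb.2.1.le) (fun b hb => hb.1)
      (fun b hb => (measure_ball_pos _ _ hb.1).ne') (fun b _ => measure_ball_lt_top.ne)
      (fun b _ => (volume_ball_mul _ (by norm_num) _).le) (fun b hb k hk => ?_) g hgm
    obtain ⟨h1, h2⟩ := smallBalls_local hκ0 hκ1 hloc hb hk
    exact rpow_mul_rpow_le_apLocConst h1 h2
  have hgN : ∫⁻ x, g x ^ p * ENNReal.ofReal (w x) ≤ N ^ p * (ENNReal.ofReal (C₂ ^ 2) * Φ) := by
    calc ∫⁻ x, g x ^ p * ENNReal.ofReal (w x)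
        = ∫⁻ x in ball c (2 ^ 2 * r), ‖f x‖ₑ ^ p * ENNReal.ofReal (w x) := by
          rw [← lintegral_indicator measurableSet_ball]
          refine lintegral_congr fun x => ?_
          by_cases hx : x ∈ ball c (2 ^ 2 * r)
          · rw [hg, Set.indicator_of_mem hx, Set.indicator_of_mem hx]
          · rw [hg, Set.indicator_of_notMem hx, Set.indicator_of_notMem hx,
              ENNReal.zero_rpow_of_pos hp0, zero_mul]
      _ ≤ N ^ p * ENNReal.ofReal (φ c (2 ^ 2 * r)) :=
          setLIntegral_le_morreyNorm hφ w hp0 _ c (by positivity)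
      _ ≤ _ := by
          rw [hΦ, ← ENNReal.ofReal_mul (by positivity)]
          gcongr
          exact hdoub c r 2 hr
  calc ∫⁻ x in ball c r, hlMaximal f x ^ p * ENNReal.ofReal (w x)
      ≤ ∫⁻ x in ball c r, (averageMaximal volume F g x ^ p * ENNReal.ofReal (w x) +
          L ^ p * ENNReal.ofReal (w x)) := by
        refine setLIntegral_mono' measurableSet_ball fun x hx => ?_
        rw [← add_mul]
        gcongr
        have h1 := hlMaximal_le_max hφ hw h0 hp0 hA hf hr hx
        rcases le_max_iff.1 h1 with h2 | h2
        · exact le_add_right (ENNReal.rpow_le_rpow h2 hp0.le)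
        · exact le_add_left (ENNReal.rpow_le_rpow h2 hp0.le)
    _ = (∫⁻ x in ball c r, averageMaximal volume F g x ^ p * ENNReal.ofReal (w x)) +
          L ^ p * m := by
        rw [lintegral_add_right' _ (hWm.const_mul _).restrict,
          lintegral_const_mul'' _ hWm.restrict]
        rfl
    _ ≤ C₁ * (N ^ p * (ENNReal.ofReal (C₂ ^ 2) * Φ)) +
          (ENNReal.ofReal (3 ^ n) * A) ^ p * N ^ p * Φ := by
        rw [hLm]
        gcongr
        exact (setLIntegral_le_lintegral _ _).trans (hsmall.trans (by gcongr))
    _ = _ := by rw [hK₀]; ring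

/-- The weak type inequality for the maximal operator on weighted Morrey spaces, `p = 1`. -/
theorem MuckenhouptMorrey.maximalWeakBounded (hn : 0 < n) {φ : Rn n → ℝ → ℝ}
    (hφ : IsPositiveOnBalls φ) (hd : IsDoubling φ) (hr : IsReverseDoubling φ) {w : Rn n → ℝ}
    (hw : IsWeight w) {κ : ℝ} (hκ0 : 0 < κ) (hκ1 : κ < 1)
    (hA : MuckenhouptMorrey φ 1 w) {a : Rn n} (ha : A1Loc κ (fun x => w (x + a))) :
    MaximalWeakBounded φ w 1 := by
  have hWm := hw.aemeasurable_ofReal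
  rcases ae_eq_zero_or_ae_ne_zero_of_muckenhouptMorrey hφ hw one_pos hA with h0 | h0
  · refine ⟨0, fun f _ => ?_⟩
    refine (weakMorreyNorm_le (K := 0) hφ fun c r hr t => ?_).trans zero_le
    rw [wMass, lintegral_congr_ae (ae_restrict_of_ae h0)]
    simp
  obtain ⟨C₂, hC₂, hdoub⟩ := hd.exists_le_pow hφ
  obtain ⟨C₃, hC₃, hglob⟩ := exists_measure_ball_le_of_local hn hφ hd hr a
    (show 0 < κ / 8 by positivity)
  set A := muckenhouptMorreyConst φ w 1 with hAdef
  set A' := a1LocConst κ (fun x => w (x + a)) with hA'def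
  set K₀ : ℝ≥0∞ := A' * ENNReal.ofReal (6 ^ n) * A' * ENNReal.ofReal (C₂ ^ 2) +
    ENNReal.ofReal (3 ^ n) * A with hK₀
  have hAtop : A ≠ ∞ := hA.ne
  have hAtop' : A' ≠ ∞ := ha.ne
  have hK₀top : C₃ * K₀ ≠ ∞ := by finiteness
  refine ⟨(C₃ * K₀).toNNReal, fun f hf => ?_⟩
  rw [ENNReal.coe_toNNReal hK₀top]
  set N := morreyNorm φ w 1 (fun x => ‖f x‖ₑ) with hN
  refine weakMorreyNorm_le hφ fun c r hr t => ?_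
  set μ : Measure (Rn n) := volume.withDensity fun x => ENNReal.ofReal (w x) with hμ
  set S : Set (Rn n) := {x | (t : ℝ≥0∞) < hlMaximal f x} with hS
  have hSm : MeasurableSet S := measurableSet_lt measurable_const (measurable_hlMaximal f)
  have hTball : ∀ (c : Rn n) (r : ℝ), ((t : ℝ≥0∞) • μ.restrict S) (ball c r) =
      t * wMass w {x ∈ ball c r | (t : ℝ≥0∞) < hlMaximal f x} := by
    intro c r
    rw [Measure.smul_apply, smul_eq_mul, Measure.restrict_apply measurableSet_ball,
      withDensity_apply _ (measurableSet_ball.inter hSm)]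
    rfl
  rw [← hTball]
  have hac : ((t : ℝ≥0∞) • μ.restrict S) ≪ volume :=
    (Measure.smul_absolutelyContinuous.trans Measure.absolutelyContinuous_restrict).trans
      (withDensity_absolutelyContinuous _ _)
  -- The measure depends on `t` and `f`, but the constant `C₃` was chosen before both, so the bound
  -- is uniform.
  refine (hglob _ hac (K₀ * N) ?_ c r hr).trans_eq (by ring)
  clear hr c r
  intro c r hr hloc
  rw [hTball]
  set F := smallBalls c r with hF
  set g : Rn n → ℝ≥0∞ := (ball c (2 ^ 2 * r)).indicator fun y => ‖f y‖ₑ with hg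
  set m := wMass w (ball c r) with hm
  set Φ := ENNReal.ofReal (φ c r) with hΦ
  have hm0 : m ≠ 0 := hw.wMass_ball_ne_zero h0 c hr
  have hmt : m ≠ ∞ := hw.wMass_ball_ne_top c r
  have hΦ0 : Φ ≠ 0 := by simpa [hΦ] using hφ c r hr
  set L := ENNReal.ofReal (3 ^ n) * A * N / (m / Φ) ^ (1 / (1 : ℝ)) with hL
  have hLm : L * m = ENNReal.ofReal (3 ^ n) * A * N * Φ := by
    rw [hL, one_div_one, ENNReal.rpow_one, div_eq_mul_inv,
      ENNReal.inv_div (Or.inl ENNReal.ofReal_ne_top) (Or.inl hΦ0), mul_assoc,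
      ENNReal.div_mul_cancel hm0 hmt]
  have hmax : ∀ x ∈ ball c r, hlMaximal f x ≤ max (averageMaximal volume F g x) L :=
    fun x hx => hlMaximal_le_max hφ hw h0 one_pos hA hf hr hx
  -- Below `L` the trivial bound `t w(B) ≤ L w(B)` is enough; above `L` only small balls can produce
  -- values exceeding `t`.
  rcases le_or_gt (t : ℝ≥0∞) L with htL | htL
  · calc (t : ℝ≥0∞) * wMass w {x ∈ ball c r | (t : ℝ≥0∞) < hlMaximal f x} ≤ L * m := by
          gcongr
          exact lintegral_mono_set fun x hx => hx.1
      _ = ENNReal.ofReal (3 ^ n) * A * N * Φ := hLm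
      _ ≤ _ := by
          rw [hK₀]
          gcongr
          exact le_add_self
  have hgm : AEMeasurable g := hf.1.enorm.indicator measurableSet_ball
  have hsmall : (t : ℝ≥0∞) * ∫⁻ x in {x | (t : ℝ≥0∞) < averageMaximal volume F g x},
      ENNReal.ofReal (w x) ≤
        A' * ENNReal.ofReal (6 ^ n) * A' * ∫⁻ x, g x * ENNReal.ofReal (w x) := by
    refine mul_lintegral_lt_averageMaximal_le hWm h0 (R := r) (fun b hb => hb.2.1.le)
      (fun b hb => hb.1)
      (fun b hb => (measure_ball_pos _ _ hb.1).ne') (fun b _ => measure_ball_lt_top.ne)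
      (fun b _ => (volume_ball_mul _ (by norm_num) _).le)
      (fun b _ => hw.wMass_ball_ne_top _ _) (fun b hb k hk => ?_) hgm t
    obtain ⟨h1, h2⟩ := smallBalls_local hκ0 hκ1 hloc hb hk
    exact ae_le_a1LocConst h0 h1 h2
  have hgN : ∫⁻ x, g x * ENNReal.ofReal (w x) ≤ N * (ENNReal.ofReal (C₂ ^ 2) * Φ) := by
    calc ∫⁻ x, g x * ENNReal.ofReal (w x)
        = ∫⁻ x in ball c (2 ^ 2 * r), ‖f x‖ₑ ^ (1 : ℝ) * ENNReal.ofReal (w x) := by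
          rw [← lintegral_indicator measurableSet_ball]
          refine lintegral_congr fun x => ?_
          by_cases hx : x ∈ ball c (2 ^ 2 * r)
          · rw [hg, Set.indicator_of_mem hx, Set.indicator_of_mem hx, ENNReal.rpow_one]
          · rw [hg, Set.indicator_of_notMem hx, Set.indicator_of_notMem hx, zero_mul]
      _ ≤ N ^ (1 : ℝ) * ENNReal.ofReal (φ c (2 ^ 2 * r)) :=
          setLIntegral_le_morreyNorm hφ w one_pos _ c (by positivity)
      _ ≤ _ := by
          rw [hΦ, ENNReal.rpow_one, ← ENNReal.ofReal_mul (by positivity)]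
          gcongr
          exact hdoub c r 2 hr
  calc (t : ℝ≥0∞) * wMass w {x ∈ ball c r | (t : ℝ≥0∞) < hlMaximal f x}
      ≤ t * ∫⁻ x in {x | (t : ℝ≥0∞) < averageMaximal volume F g x}, ENNReal.ofReal (w x) := by
        gcongr
        refine lintegral_mono_set fun x hx => ?_
        rcases lt_max_iff.1 (lt_of_lt_of_le hx.2 (hmax x hx.1)) with h | h
        · exact h
        · exact absurd h htL.not_gt
    _ ≤ A' * ENNReal.ofReal (6 ^ n) * A' * (N * (ENNReal.ofReal (C₂ ^ 2) * Φ)) :=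
        hsmall.trans (by gcongr)
    _ = A' * ENNReal.ofReal (6 ^ n) * A' * ENNReal.ofReal (C₂ ^ 2) * N * Φ := by ring
    _ ≤ _ := by
        rw [hK₀]
        gcongr
        exact le_self_add

end Morrey

theorem mainTheorem4 {n : ℕ} (hn : 0 < n)
    (φ : Morrey.Rn n → ℝ → ℝ) (hφ_pos : Morrey.IsPositiveOnBalls φ)
    (hφ_doubling : Morrey.IsDoubling φ) (hφ_reverse : Morrey.IsReverseDoubling φ)
    (w : Morrey.Rn n → ℝ) (hw : Morrey.IsWeight w)
    (p : ℝ) (hp : 1 ≤ p)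
    (hball : ∀ (c : Morrey.Rn n) (r : ℝ), 0 < r → Morrey.MemMorrey φ w p (Morrey.ballChar c r))
    (κ : ℝ) (hκ0 : 0 < κ) (hκ1 : κ < 1) :
    (Morrey.MaximalWeakBounded φ w p → Morrey.MuckenhouptMorrey φ p w) ∧
    (1 < p → Morrey.MuckenhouptMorrey φ p w →
      (∃ a : Morrey.Rn n, Morrey.ApLoc κ p (fun x => w (x + a))) →
      Morrey.MaximalBounded φ w p) ∧
    (p = 1 → Morrey.MuckenhouptMorrey φ 1 w →
      (∃ a : Morrey.Rn n, Morrey.A1Loc κ (fun x => w (x + a))) →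
      Morrey.MaximalWeakBounded φ w 1) :=
  ⟨fun h => h.muckenhouptMorrey (by linarith),
    fun hp1 hA ⟨_, ha⟩ => hA.maximalBounded hn hφ_pos hφ_doubling hφ_reverse hw hp1 hκ0 hκ1 ha,
    fun _ hA ⟨_, ha⟩ => hA.maximalWeakBounded hn hφ_pos hφ_doubling hφ_reverse hw hκ0 hκ1 ha⟩
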